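/- A temporal Lorentzian spectral triple $(\mathcal A,\widetilde{\mathcal A},\mathcal H,D,\mathcal T)$ consists of a Hilbert space $\mathcal H$; a $*$-algebra $\mathcal A\subset B(\mathcal H)$ without unit which is an ideal of a unital $*$-algebra $\widetilde{\mathcal A}\subset B(\mathcal H)$; an unbounded self-adjoint operator $\mathcal T$ with $(1+\mathcal T^2)^{-1/2}\in\widetilde{\mathcal A}$; and a densely defined operator $D$ such that $[D,a]$ is bounded for all $a\in\widetilde{\mathcal A}$; $[D,\mathcal T]$ is self-adjoint, commutes with $\widetilde{\mathcal A}$, and $[D,\mathcal T]^2=u\in\widetilde{\mathcal A}$ with $u>0$ (positive and invertible); $[D,\mathcal T]D$ is skew-self-adjoint; and $a(1+\langle D\rangle^2)^{-1/2}$ is compact for all $a\in\mathcal A$, where $\langle D\rangle^2=-\tfrac12\big(D[D,\mathcal T]D[D,\mathcal T]+[D,\mathcal T]D[D,\mathcal T]D\big)$. Let $(M,g)$ be a smooth pseudo-Riemannian $n$-manifold of arbitrary signature with a spin structure and a spacelike reflection, and let $S$ be its spinor bundle. The Clifford action satisfies $c(\xi)^2=g^{-1}(\xi,\xi)$, and $S$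 carries the Hermitian structure for which the gamma matrices $\gamma^a=c(e^a)$ of the pseudo-orthonormal coframes $(e^a)$ adapted to the reflection are Hermitian if $g^{-1}(e^a,e^a)=1$ and anti-Hermitian if $g^{-1}(e^a,e^a)=-1$. Let $(\mathcal A,\widetilde{\mathcal A},\mathcal H,D,\mathcal T)$ be a temporal Lorentzian spectral triple with commutative algebra that comes from this spin manifold: $\mathcal H=L^2(M,S)$ with $(\psi,\phi)=\int_M\psi^*\phi\,d\mu_g$, $d\mu_g=\sqrt{|\det g|}\,d^nx$; the elements of $\mathcal A$ (resp. $\widetilde{\mathcal A}$) act by multiplication with smooth functions vanishing at infinity (resp. smooth bounded functions); $\mathcal T$ acts by multiplication with a smooth function $\mathcal T:M\to\mathbb R$; and $D$ acts on smooth compactly supported spinor fields as the Dirac operator $-i\,c\circ\nabla^S$. Then: 1. $g^{-1}(d\mathcal T,d\mathcal T)<0$ everywhere (in particular $d\mathcal T$ vanishes nowhere), and $g$ has Lorentzian signature $(-,+,\dots,+)$. 2. $c(d\mathcal T)$ is anti-Hermitian, and $c(\xi)$ is Hermitian for every covector $\xi$ with $g^{-1}(d\mathcal T,\xi)=0$.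 3. The metric splits globally and orthogonally: $g=-\beta\,d\mathcal T^2+h$ with $\beta$ a smooth positive function and $h$ a smooth symmetric $2$-tensor field that is positive definite on the tangent spaces $\ker d\mathcal T$ of the level sets of $\mathcal T$ and satisfies $h(\nabla\mathcal T,\cdot)=0$, where $\nabla\mathcal T$ is transversal to $\ker d\mathcal T$. 4. In any local coordinates with $x^0=\mathcal T$ one has $g^{00}<0$; and if at a point each gamma matrix $\gamma^\mu=c(dx^\mu)$ is either Hermitian or anti-Hermitian, then at that point $\gamma^\mu$ is Hermitian and $g^{0\mu}=0$ for all $\mu>0$. -/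

import Mathlib

open scoped Manifold ContDiff Topology InnerProductSpace

noncomputable section

/-! ### Unbounded operators and temporal Lorentzian spectral triples -/

namespace UnboundedOp

variable {H : Type*} [NormedAddCommGroup H] [InnerProductSpace ℂ H]

/-- The product `f g` of two unbounded operators, on its natural domain
`{x ∈ Dom g | g x ∈ Dom f}`. -/
def mul (f g : H →ₗ.[ℂ] H) : H →ₗ.[ℂ] H where
  domain :=
    { carrier := {x | ∃ hx : x ∈ g.domain, g ⟨x, hx⟩ ∈ f.domain}
      zero_mem' := ⟨g.domain.zero_mem, by
        have h : g ⟨0, g.domain.zero_mem⟩ = 0 := g.map_zero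
        rw [h]
        exact f.domain.zero_mem⟩
      add_mem' := by
        rintro x y ⟨hx, hx'⟩ ⟨hy, hy'⟩
        refine ⟨g.domain.add_mem hx hy, ?_⟩
        have h : g ⟨x + y, g.domain.add_mem hx hy⟩ = g ⟨x, hx⟩ + g ⟨y, hy⟩ :=
          g.map_add ⟨x, hx⟩ ⟨y, hy⟩
        rw [h]
        exact f.domain.add_mem hx' hy'
      smul_mem' := by
        rintro z x ⟨hx, hx'⟩
        refine ⟨g.domain.smul_mem z hx, ?_⟩
        have h : g ⟨z • x, g.domain.smul_mem z hx⟩ = z • g ⟨x, hx⟩ := g.map_smul z ⟨x, hx⟩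
        rw [h]
        exact f.domain.smul_mem z hx' }
  toFun :=
    { toFun := fun x => f ⟨g ⟨x.1, x.2.choose⟩, x.2.choose_spec⟩
      map_add' := by
        rintro ⟨x, hx, hx'⟩ ⟨y, hy, hy'⟩
        refine Eq.trans ?_ (f.map_add ⟨g ⟨x, hx⟩, hx'⟩ ⟨g ⟨y, hy⟩, hy'⟩)
        exact congrArg f (Subtype.ext (g.map_add ⟨x, hx⟩ ⟨y, hy⟩))
      map_smul' := by
        rintro z ⟨x, hx, hx'⟩
        refine Eq.trans ?_ (f.map_smul z ⟨g ⟨x, hx⟩, hx'⟩)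
        exact congrArg f (Subtype.ext (g.map_smul z ⟨x, hx⟩)) }

/-- A bounded operator regarded as an everywhere defined unbounded operator. -/
def ofBounded (B : H →L[ℂ] H) : H →ₗ.[ℂ] H := (B : H →ₗ[ℂ] H).toPMap ⊤

/-- The operator `1 + P`, on the domain of `P`. -/
def onePlus (P : H →ₗ.[ℂ] H) : H →ₗ.[ℂ] H := ofBounded 1 + P

/-- The closure of `P` is the everywhere defined bounded operator `B`. -/
def ClosureIsBounded (P : H →ₗ.[ℂ] H) (B : H →L[ℂ] H) : Prop :=
  ∀ x y : H, (x, y) ∈ P.graph.topologicalClosure ↔ y = B x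

/-- `R = P^{-1/2}` for a (possibly only essentially closed) unbounded operator `P`:
the bounded operator `R²` is the inverse of the closure of `P`, and `R` is the principal square
root of `R²`, that is, its spectrum lies in the closed right half plane.
For a positive self-adjoint `P` this is the usual positive operator `P^{-1/2}`. -/
def IsInvSqrt (P : H →ₗ.[ℂ] H) (R : H →L[ℂ] H) : Prop :=
  (∀ x y : H, (x, y) ∈ P.graph.topologicalClosure ↔ x = R (R y)) ∧
    ∀ z ∈ spectrum ℂ R, 0 ≤ z.re

end UnboundedOp

open UnboundedOp in
/-- A temporal Lorentzian spectral triple `(A, Ã, H, D, T)` on the Hilbert space `H`.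
The pre-`C⋆`-algebras are identified with their images under the faithful representation on `H`. -/
structure TemporalLorentzianSpectralTriple (H : Type*) [NormedAddCommGroup H]
    [InnerProductSpace ℂ H] [CompleteSpace H] where
  /-- the algebra `A` -/
  alg : NonUnitalStarSubalgebra ℂ (H →L[ℂ] H)
  /-- the preferred unitization `Ã` of `A` -/
  algTilde : StarSubalgebra ℂ (H →L[ℂ] H)
  /-- `A` has no unit -/
  nonunital : ¬ ∃ e ∈ alg, ∀ a ∈ alg, e * a = a ∧ a * e = a
  alg_le : ∀ a ∈ alg, a ∈ algTilde
  /-- `A` is an ideal of `Ã` -/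
  ideal : ∀ a ∈ alg, ∀ b ∈ algTilde, a * b ∈ alg ∧ b * a ∈ alg
  /-- the time operator `T` -/
  T : H →ₗ.[ℂ] H
  T_selfAdjoint : IsSelfAdjoint T
  /-- `(1 + T²)^{-1/2} ∈ Ã` -/
  T_inv_mem : ∃ R ∈ algTilde, IsInvSqrt (onePlus (mul T T)) R
  /-- the Dirac operator `D` -/
  D : H →ₗ.[ℂ] H
  D_dense : Dense (D.domain : Set H)
  /-- for `a ∈ Ã` the commutator `[D, a]` is defined on `Dom D` and bounded -/
  commutator_bounded : ∀ a ∈ algTilde, ∃ B : H →L[ℂ] H, ∀ x : D.domain,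
    ∃ hx : a x ∈ D.domain, D ⟨a x, hx⟩ - a (D x) = B x
  /-- the operator `[D, T]`; it is bounded, its square being an element of `Ã` -/
  commDT : H →L[ℂ] H
  commDT_eq : ClosureIsBounded (mul D T - mul T D) commDT
  commDT_selfAdjoint : IsSelfAdjoint commDT
  commDT_commute : ∀ a ∈ algTilde, commDT * a = a * commDT
  /-- `u = [D, T]² ∈ Ã` -/
  commDT_sq_mem : commDT * commDT ∈ algTilde
  /-- `u > 0`, i.e. `u` is positive and invertible -/
  commDT_sq_pos : IsStrictlyPositive (commDT * commDT)
  /-- `[D, T] D` is skew-self-adjoint -/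
  skewAdjoint : (mul (ofBounded commDT) D).adjoint = -(mul (ofBounded commDT) D)
  /-- `a (1 + ⟨D⟩²)^{-1/2}` is compact for `a ∈ A`, where
  `⟨D⟩² = -½ (D [D,T] D [D,T] + [D,T] D [D,T] D)` -/
  compact : ∃ R : H →L[ℂ] H,
    IsInvSqrt (onePlus ((-(1 / 2 : ℂ)) •
      (mul (mul D (ofBounded commDT)) (mul D (ofBounded commDT)) +
        mul (mul (ofBounded commDT) D) (mul (ofBounded commDT) D)))) R ∧
    ∀ a ∈ alg, IsCompactOperator (a * R)

/-- The algebra of the triple is commutative. -/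
def TemporalLorentzianSpectralTriple.IsCommutative {H : Type*} [NormedAddCommGroup H]
    [InnerProductSpace ℂ H] [CompleteSpace H] (X : TemporalLorentzianSpectralTriple H) : Prop :=
  ∀ a ∈ X.algTilde, ∀ b ∈ X.algTilde, a * b = b * a

/-! ### Pseudo-Riemannian metrics -/

section Geometry

variable {n : ℕ} {M : Type*} [TopologicalSpace M] [ChartedSpace (EuclideanSpace ℝ (Fin n)) M]

/-- The differential `df` of a real function, as a field of covectors. -/
def differential (f : M → ℝ) (x : M) : TangentSpace (𝓡 n) x →L[ℝ] ℝ :=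
  mfderiv (𝓡 n) 𝓘(ℝ, ℝ) f x

/-- The coordinate function `x^μ` of a chart. -/
def coordFun (e : OpenPartialHomeomorph M (EuclideanSpace ℝ (Fin n))) (μ : Fin n) : M → ℝ :=
  fun y => e y μ

/-- The coordinate vector `∂_μ` of a chart, at the point with coordinates `y`. -/
def coordVec (e : OpenPartialHomeomorph M (EuclideanSpace ℝ (Fin n))) (μ : Fin n)
    (y : EuclideanSpace ℝ (Fin n)) : TangentSpace (𝓡 n) (e.symm y) :=
  mfderiv (𝓡 n) (𝓡 n) e.symm y (EuclideanSpace.single μ (1 : ℝ))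

variable [IsManifold (𝓡 n) ∞ M]

/-- A field of bilinear forms on the tangent spaces is a smooth covariant 2-tensor field. -/
def IsSmoothTwoTensor
    (h : (x : M) → TangentSpace (𝓡 n) x →L[ℝ] TangentSpace (𝓡 n) x →L[ℝ] ℝ) : Prop :=
  ContMDiff (𝓡 n)
    ((𝓡 n).prod 𝓘(ℝ, EuclideanSpace ℝ (Fin n) →L[ℝ] EuclideanSpace ℝ (Fin n) →L[ℝ] ℝ)) ∞
    (fun x => Bundle.TotalSpace.mk' (EuclideanSpace ℝ (Fin n) →L[ℝ] EuclideanSpace ℝ (Fin n) →L[ℝ] ℝ)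
      (E := fun x : M => TangentSpace (𝓡 n) x →L[ℝ] TangentSpace (𝓡 n) x →L[ℝ] ℝ) x (h x))

variable (n M) in
/-- A smooth pseudo-Riemannian metric (of arbitrary signature) on the `n`-manifold `M`. -/
structure PseudoRiemannianMetric where
  /-- the bilinear form `g_x` -/
  val : (x : M) → TangentSpace (𝓡 n) x →L[ℝ] TangentSpace (𝓡 n) x →L[ℝ] ℝ
  symm : ∀ x v w, val x v w = val x w v
  nondegenerate : ∀ x v, (∀ w, val x v w = 0) → v = 0
  smooth : IsSmoothTwoTensor val

namespace PseudoRiemannianMetric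

variable (g : PseudoRiemannianMetric n M)

lemma flat_injective (x : M) : Function.Injective
    ((ContinuousLinearMap.coeLM ℝ : (TangentSpace (𝓡 n) x →L[ℝ] ℝ) →ₗ[ℝ] _).comp
      (g.val x : TangentSpace (𝓡 n) x →ₗ[ℝ] (TangentSpace (𝓡 n) x →L[ℝ] ℝ))) := by
  rw [← LinearMap.ker_eq_bot, LinearMap.ker_eq_bot']
  intro v hv
  exact g.nondegenerate x v fun w => LinearMap.congr_fun hv w

lemma exists_sharp (x : M) (ξ : TangentSpace (𝓡 n) x →L[ℝ] ℝ) :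
    ∃ v : TangentSpace (𝓡 n) x, ∀ w, g.val x v w = ξ w := by
  have : FiniteDimensional ℝ (TangentSpace (𝓡 n) x) :=
    inferInstanceAs (FiniteDimensional ℝ (EuclideanSpace ℝ (Fin n)))
  have hs := (LinearMap.injective_iff_surjective_of_finrank_eq_finrank
    (Subspace.dual_finrank_eq (K := ℝ) (V := TangentSpace (𝓡 n) x)).symm).1 (g.flat_injective x)
  obtain ⟨v, hv⟩ := hs (ξ : TangentSpace (𝓡 n) x →ₗ[ℝ] ℝ)
  exact ⟨v, fun w => LinearMap.congr_fun hv w⟩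

/-- The vector `ξ^♯` with `g(ξ^♯, w) = ξ(w)` for all `w`. -/
def sharp (x : M) (ξ : TangentSpace (𝓡 n) x →L[ℝ] ℝ) : TangentSpace (𝓡 n) x :=
  (g.exists_sharp x ξ).choose

lemma sharp_spec (x : M) (ξ : TangentSpace (𝓡 n) x →L[ℝ] ℝ) (w : TangentSpace (𝓡 n) x) :
    g.val x (g.sharp x ξ) w = ξ w :=
  (g.exists_sharp x ξ).choose_spec w

/-- The inverse metric on covectors; `g^{μν} = cometric (dx^μ) (dx^ν)`. -/
def cometric (x : M) (ξ ζ : TangentSpace (𝓡 n) x →L[ℝ] ℝ) : ℝ :=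
  ξ (g.sharp x ζ)

/-- `g` has Lorentzian signature `(-, +, …, +)` at every point: some vector is timelike, and `g` is
positive definite on its orthogonal complement. -/
def IsLorentzian : Prop :=
  ∀ x : M, ∃ v : TangentSpace (𝓡 n) x, g.val x v v < 0 ∧
    ∀ w : TangentSpace (𝓡 n) x, g.val x v w = 0 → w ≠ 0 → 0 < g.val x w w

/-- The global orthogonal splitting `g = -β dτ² + h` along the function `τ`: `β` is a smooth
positive function and `h` is a smooth symmetric tensor field which restricts to a Riemannian metric
on the level sets of `τ` (whose tangent spaces are the kernels of `dτ`) and vanishes on the gradient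
of `τ`, which is transversal to the level sets. -/
def SplitsAlong (τ : M → ℝ) : Prop :=
  ∃ (β : M → ℝ) (h : (x : M) → TangentSpace (𝓡 n) x →L[ℝ] TangentSpace (𝓡 n) x →L[ℝ] ℝ),
    ContMDiff (𝓡 n) 𝓘(ℝ, ℝ) ∞ β ∧ (∀ x, 0 < β x) ∧
    IsSmoothTwoTensor h ∧ (∀ x v w, h x v w = h x w v) ∧
    ∀ x,
      (∀ v w, g.val x v w = -(β x) * (differential τ x v * differential τ x w) + h x v w) ∧
      (∀ v, differential τ x v = 0 → v ≠ 0 → 0 < h x v v) ∧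
      (∀ w, h x (g.sharp x (differential τ x)) w = 0) ∧
      differential τ x (g.sharp x (differential τ x)) ≠ 0

/-- `det (g_{μν})` in a chart, at the point with coordinates `y`. -/
def coordDet (e : OpenPartialHomeomorph M (EuclideanSpace ℝ (Fin n)))
    (y : EuclideanSpace ℝ (Fin n)) : ℝ :=
  Matrix.det (Matrix.of fun μ ν => g.val (e.symm y) (coordVec e μ y) (coordVec e ν y))

/-- `m` is the pseudo-Riemannian density `dμ_g`: in every smooth chart it is
`√|det g| dx¹ ⋯ dxⁿ`. -/
def IsVolume [MeasurableSpace M] (m : MeasureTheory.Measure M) : Prop :=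
  ∀ e ∈ IsManifold.maximalAtlas (𝓡 n) ∞ M, ∀ s ⊆ e.source, MeasurableSet s →
    m s = ∫⁻ y in e '' s, ENNReal.ofReal (√|g.coordDet e y|)

end PseudoRiemannianMetric

/-! ### Spin structures, spinor fields and the Dirac operator -/

/-- The complex spinor module of dimension `2^⌊n/2⌋`, with its standard Hermitian product. -/
abbrev SpinorSpace (n : ℕ) := EuclideanSpace ℂ (Fin (2 ^ (n / 2)))

/-- Flat gamma matrices in dimension `n` with signs `η`: they satisfy the Clifford relations
`γ^a γ^b + γ^b γ^a = 2 η^{ab}`, and each is Hermitian or anti-Hermitian according to its sign. -/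
structure GammaMatrices (n : ℕ) where
  η : Fin n → ℝ
  η_sign : ∀ a, η a = 1 ∨ η a = -1
  γ : Fin n → SpinorSpace n →L[ℂ] SpinorSpace n
  clifford : ∀ a b, γ a * γ b + γ b * γ a = if a = b then ((2 * η a : ℝ) : ℂ) • 1 else 0
  adjoint : ∀ a, star (γ a) = ((η a : ℝ) : ℂ) • γ a

namespace GammaMatrices

variable (G : GammaMatrices n)

/-- Clifford multiplication by the vector with components `v a`. -/
def cliff (v : Fin n → ℝ) : SpinorSpace n →L[ℂ] SpinorSpace n :=
  ∑ a, ((v a : ℝ) : ℂ) • G.γ a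

/-- Unit vectors of `ℝ^{p,q}` that are purely spacelike or purely timelike. -/
def IsUnitVector (v : Fin n → ℝ) : Prop :=
  (∑ a, v a ^ 2 = 1) ∧ ((∀ a, v a ≠ 0 → G.η a = 1) ∨ (∀ a, v a ≠ 0 → G.η a = -1))

/-- The subgroup of `Spin(p,q)` lying over `S(O(p) × O(q))`, acting on spinors: all products of an
even number of purely spacelike or purely timelike unit vectors. (It is the structure group left
after a reduction of a `Spin(p,q)`-structure by a spacelike reflection, and it acts unitarily.) -/
def spinGroup : Submonoid (SpinorSpace n →L[ℂ] SpinorSpace n) :=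
  Submonoid.closure {s | ∃ v w, G.IsUnitVector v ∧ G.IsUnitVector w ∧ s = G.cliff v * G.cliff w}

end GammaMatrices

/-- A spin structure on `(M, g)`, together with a spacelike reflection, presented by local
trivialisations: open sets `U i` covering `M`, smooth pseudo-orthonormal frames `E i` over them,
adapted to the reflection (which changes the sign of the frame vectors of negative square), and
`Spin`-valued transition functions satisfying the cocycle condition and lifting the transition
functions of the frames. -/
structure SpinStructure (g : PseudoRiemannianMetric n M) where
  gam : GammaMatrices n
  ι : Type*
  U : ι → Set M
  isOpen_U : ∀ i, IsOpen (U i)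
  cover : ∀ x, ∃ i, x ∈ U i
  /-- the frame vector fields `E_a` over `U i` -/
  E : ι → Fin n → (x : M) → TangentSpace (𝓡 n) x
  E_smooth : ∀ i a, ContMDiffOn (𝓡 n) (𝓡 n).tangent ∞
    (fun x => (⟨x, E i a x⟩ : TangentBundle (𝓡 n) M)) (U i)
  E_orthonormal : ∀ i, ∀ x ∈ U i, ∀ a b,
    g.val x (E i a x) (E i b x) = if a = b then gam.η a else 0
  /-- the transition functions -/
  lam : ι → ι → M → (SpinorSpace n →L[ℂ] SpinorSpace n)
  lam_smooth : ∀ i j, ContMDiffOn (𝓡 n) 𝓘(ℝ, SpinorSpace n →L[ℂ] SpinorSpace n) ∞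
    (lam i j) (U i ∩ U j)
  lam_mem : ∀ i j, ∀ x ∈ U i ∩ U j, lam i j x ∈ gam.spinGroup
  lam_cocycle : ∀ i j k, ∀ x ∈ U i ∩ U j ∩ U k, lam i j x * lam j k x = lam i k x
  lam_lifts : ∀ i j, ∀ x ∈ U i ∩ U j, ∀ ξ : TangentSpace (𝓡 n) x →L[ℝ] ℝ,
    gam.cliff (fun a => ξ (E i a x)) * lam i j x = lam i j x * gam.cliff (fun a => ξ (E j a x))

namespace SpinStructure

variable {g : PseudoRiemannianMetric n M} (S : SpinStructure g)

/-- The Clifford action `c(ξ) = ∑ ξ(E_a) γ^a` of a covector on spinors, in the trivialisation `i`;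
it satisfies `c(ξ)² = g^{-1}(ξ, ξ)`. -/
def c (i : S.ι) (x : M) (ξ : TangentSpace (𝓡 n) x →L[ℝ] ℝ) :
    SpinorSpace n →L[ℂ] SpinorSpace n :=
  S.gam.cliff fun a => ξ (S.E i a x)

/-- Smooth compactly supported sections of the spinor bundle, given by the families `ψ i` of their
components in the trivialisations (extended by zero outside `U i`). -/
def testSpinors : Submodule ℂ (S.ι → M → SpinorSpace n) where
  carrier := {ψ | (∀ i, ∀ x ∉ S.U i, ψ i x = 0) ∧
    (∀ i j, ∀ x ∈ S.U i ∩ S.U j, ψ i x = S.lam i j x (ψ j x)) ∧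
    (∀ i, ContMDiffOn (𝓡 n) 𝓘(ℝ, SpinorSpace n) ∞ (ψ i) (S.U i)) ∧
    ∃ K : Set M, IsCompact K ∧ ∀ i, ∀ x ∉ K, ψ i x = 0}
  zero_mem' := ⟨fun _ _ _ => rfl, fun _ _ _ _ => by simp, fun _ => contMDiffOn_const,
    ∅, isCompact_empty, fun _ _ _ => rfl⟩
  add_mem' := by
    rintro ψ φ ⟨h1, h2, h3, K, hK, h4⟩ ⟨k1, k2, k3, L, hL, k4⟩
    refine ⟨fun i x hx => ?_, fun i j x hx => ?_, fun i => (h3 i).add (k3 i),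
      K ∪ L, hK.union hL, fun i x hx => ?_⟩
    · simp [h1 i x hx, k1 i x hx]
    · simp only [Pi.add_apply, map_add]
      rw [h2 i j x hx, k2 i j x hx]
    · rw [Set.mem_union, not_or] at hx
      simp [h4 i x hx.1, k4 i x hx.2]
  smul_mem' := by
    rintro z ψ ⟨h1, h2, h3, K, hK, h4⟩
    refine ⟨fun i x hx => ?_, fun i j x hx => ?_, fun i => ?_, K, hK, fun i x hx => ?_⟩
    · simp [h1 i x hx]
    · simp only [Pi.smul_apply, map_smul]
      rw [h2 i j x hx]
    · exact (contDiff_const_smul z).contMDiff.comp_contMDiffOn (h3 i)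
    · simp [h4 i x hx]

/-- The product of a spinor field with a smooth complex function. -/
def mulSpinor (f : M → ℂ) (hf : ContMDiff (𝓡 n) 𝓘(ℝ, ℂ) ∞ f) (ψ : S.testSpinors) :
    S.testSpinors :=
  ⟨fun i x => f x • ψ.1 i x, by
    obtain ⟨ψ, h1, h2, h3, K, hK, h4⟩ := ψ
    refine ⟨fun i x hx => ?_, fun i j x hx => ?_, fun i => ?_, K, hK, fun i x hx => ?_⟩
    · simp [h1 i x hx]
    · simp only [map_smul]
      rw [h2 i j x hx]
    · have hsm : ContDiff ℝ ∞ fun p : ℂ × SpinorSpace n => p.1 • p.2 :=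
        contDiff_fst.smul contDiff_snd
      exact hsm.contMDiff.comp_contMDiffOn (hf.contMDiffOn.prodMk_space (h3 i))
    · simp [h4 i x hx]⟩

/-- The pointwise Hermitian product `ψ^*φ` of two spinor fields, which does not depend on the
trivialisation used to compute it. -/
def pointwiseInner (ψ φ : S.ι → M → SpinorSpace n) (x : M) : ℂ :=
  ⟪ψ (S.cover x).choose x, φ (S.cover x).choose x⟫_ℂ

/-- The Levi-Civita connection coefficients `ω_{bc}(E_a) = g(E_b, ∇_{E_a} E_c)` of the frame `i`,
by the Koszul formula for a pseudo-orthonormal frame. -/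
def omega (i : S.ι) (a b c : Fin n) (x : M) : ℝ :=
  (1 / 2) * (g.val x (VectorField.mlieBracket (𝓡 n) (S.E i a) (S.E i c) x) (S.E i b x)
    - g.val x (VectorField.mlieBracket (𝓡 n) (S.E i a) (S.E i b) x) (S.E i c x)
    - g.val x (VectorField.mlieBracket (𝓡 n) (S.E i c) (S.E i b) x) (S.E i a x))

/-- The derivative of a spinor-valued function along a tangent vector. -/
def spinorDeriv (ψ : M → SpinorSpace n) (x : M) (v : TangentSpace (𝓡 n) x) : SpinorSpace n :=
  mfderiv (𝓡 n) 𝓘(ℝ, SpinorSpace n) ψ x v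

/-- The spin connection `∇^S_{E_a} ψ = E_a ψ + ¼ ∑ ω_{bc}(E_a) γ^b γ^c ψ` in the trivialisation
`i`. -/
def nabla (i : S.ι) (a : Fin n) (ψ : M → SpinorSpace n) (x : M) : SpinorSpace n :=
  spinorDeriv ψ x (S.E i a x)
    + (1 / 4 : ℂ) • ∑ b, ∑ c, ((S.omega i a b c x : ℝ) : ℂ) • S.gam.γ b (S.gam.γ c (ψ x))

/-- `χ = D ψ`, where `D = -i (c ∘ ∇^S) = -i ∑ γ^a ∇^S_{E_a}` is the Dirac operator. -/
def IsDirac (ψ χ : S.ι → M → SpinorSpace n) : Prop :=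
  ∀ i, ∀ x ∈ S.U i, χ i x = (-Complex.I) • ∑ a, S.gam.γ a (S.nabla i a (ψ i) x)

end SpinStructure

/-! ### Triples that come from a pseudo-Riemannian spin manifold -/

/-- The spectral triple `X` comes from the pseudo-Riemannian spin manifold `(M, g)` with spin
structure `S` and time function `time`: `H = L²(M, S)`, the algebras act by multiplication with
smooth functions (vanishing at infinity, resp. bounded), `T` acts as multiplication by the real
smooth function `time`, and `D` as the Dirac operator. -/
structure ComesFromSpinManifold {H : Type*} [NormedAddCommGroup H] [InnerProductSpace ℂ H]
    [CompleteSpace H] [MeasurableSpace M] {g : PseudoRiemannianMetric n M}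
    (X : TemporalLorentzianSpectralTriple H) (S : SpinStructure g) (time : M → ℝ) where
  /-- the pseudo-Riemannian density `dμ_g` -/
  vol : MeasureTheory.Measure M
  isVolume : g.IsVolume vol
  /-- `H` is the space of square integrable spinor fields, that is, the completion of the space of
  smooth compactly supported ones for `(ψ, φ) = ∫ ψ^*φ dμ_g`: `toH` is the canonical map. -/
  toH : S.testSpinors →ₗ[ℂ] H
  dense_toH : DenseRange toH
  inner_toH : ∀ ψ φ : S.testSpinors, ⟪toH ψ, toH φ⟫_ℂ = ∫ x, S.pointwiseInner ψ.1 φ.1 x ∂vol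
  /-- `Ã` acts by multiplication with smooth bounded functions -/
  algTilde_mul : ∀ a ∈ X.algTilde, ∃ (f : M → ℂ) (hf : ContMDiff (𝓡 n) 𝓘(ℝ, ℂ) ∞ f),
    (∃ C : ℝ, ∀ x, ‖f x‖ ≤ C) ∧ ∀ ψ, a (toH ψ) = toH (S.mulSpinor f hf ψ)
  /-- `A` acts by multiplication with smooth functions vanishing at infinity -/
  alg_mul : ∀ a ∈ X.alg, ∃ (f : M → ℂ) (hf : ContMDiff (𝓡 n) 𝓘(ℝ, ℂ) ∞ f),
    Filter.Tendsto f (Filter.cocompact M) (𝓝 0) ∧ ∀ ψ, a (toH ψ) = toH (S.mulSpinor f hf ψ)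
  time_smooth : ContMDiff (𝓡 n) 𝓘(ℝ, ℂ) ∞ fun x => (time x : ℂ)
  /-- `T` acts by multiplication with `time` (being self-adjoint, it is then the closure of this
  multiplication operator on smooth compactly supported spinor fields) -/
  T_mul : ∀ ψ, (toH ψ, toH (S.mulSpinor (fun x => (time x : ℂ)) time_smooth ψ)) ∈ X.T.graph
  /-- `D` acts on smooth compactly supported spinor fields as the Dirac operator, i.e. it is
  a closed extension of the Dirac operator on that initial domain -/
  D_dirac : ∀ ψ : S.testSpinors, ∃ χ : S.testSpinors,
    S.IsDirac ψ.1 χ.1 ∧ (toH ψ, toH χ) ∈ X.D.graph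

end Geometry

end

/-! On test spinors the Leibniz rule gives [D, f] = -i c(df) for real smooth f, because the
zeroth-order part of the spin connection is linear and cancels (`mulSpinor_sub_of_isDirac`). Hence J
= [D, T] acts as -i c(dT), and the conditions on J become conditions on matrices at every point
(`isTemporal`).

Self-adjointness of J makes c(dT) anti-Hermitian. Invertibility of J² bounds ‖s‖² by C‖c(dT)s‖² = -C
g⁻¹(dT,dT)‖s‖², so dT is timelike. As J D is skew-adjoint and f is symmetric, [J D, f] = J [D, f] is
symmetric; it acts as -c(dT)c(df), and df at a point is arbitrary, so c(dT)c(ξ) is Hermitian for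
every ξ. The passage from L² to points multiplies test spinors by bump functions
(`norm_sq_le_of_norm_toH_sq_le`, `isSelfAdjoint_of_inner_toH_eq`).

The rest is linear algebra. If ξ ⊥ dT, then c(ξ) anticommutes with c(dT), so Hermiticity of
c(dT)c(ξ) forces that of c(ξ) (`isSelfAdjoint_c`). Then g⁻¹(ξ,ξ) = c(ξ)*c(ξ) ≥ 0, with equality only
for ξ = 0: the metric is positive definite orthogonally to dT. This gives the signature and, with β
= -1/g⁻¹(dT,dT), the splitting. For ξ = r dT + ζ with ζ ⊥ dT, the adjoint of c(ξ) only flips the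
sign of the dT part, so c(ξ) is Hermitian only if r = 0 and anti-Hermitian only if ζ = 0. An
anti-Hermitian γ^μ with μ > 0 would therefore make dx^μ proportional to dx^0. -/

open scoped Manifold ContDiff Topology InnerProductSpace

noncomputable section

/-! ### Clifford algebra at a point. -/

section

section Algebra

variable {A : Type*} [Ring A] [Algebra ℂ A]

lemma sum_ofReal_smul_add {n : ℕ} (γ : Fin n → A) (v w : Fin n → ℝ) :
    ∑ a, (((v + w) a : ℝ) : ℂ) • γ a = ∑ a, ((v a : ℝ) : ℂ) • γ a + ∑ a, ((w a : ℝ) : ℂ) • γ a := by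
  simp [add_smul, Finset.sum_add_distrib]

lemma sum_ofReal_smul_smul {n : ℕ} (γ : Fin n → A) (r : ℝ) (v : Fin n → ℝ) :
    ∑ a, (((r • v) a : ℝ) : ℂ) • γ a = (r : ℂ) • ∑ a, ((v a : ℝ) : ℂ) • γ a := by
  simp [mul_smul, Finset.smul_sum]

lemma sum_ofReal_smul_mul_add {n : ℕ} {γ : Fin n → A} {η : Fin n → ℝ}
    (h : ∀ a b, γ a * γ b + γ b * γ a = if a = b then ((2 * η a : ℝ) : ℂ) • 1 else 0)
    (v w : Fin n → ℝ) :
    (∑ a, ((v a : ℝ) : ℂ) • γ a) * (∑ a, ((w a : ℝ) : ℂ) • γ a) +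
      (∑ a, ((w a : ℝ) : ℂ) • γ a) * (∑ a, ((v a : ℝ) : ℂ) • γ a) =
      ((2 * ∑ a, η a * v a * w a : ℝ) : ℂ) • 1 := by
  have e : (∑ a, ((v a : ℝ) : ℂ) • γ a) * (∑ a, ((w a : ℝ) : ℂ) • γ a) +
      (∑ a, ((w a : ℝ) : ℂ) • γ a) * (∑ a, ((v a : ℝ) : ℂ) • γ a) =
      ∑ a, ∑ b, ((v a * w b : ℝ) : ℂ) • (γ a * γ b + γ b * γ a) := by
    simp only [Finset.sum_mul_sum, smul_add, Finset.sum_add_distrib]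
    congr 1
    · simp only [smul_mul_smul_comm, Complex.ofReal_mul]
    · rw [Finset.sum_comm]
      simp only [smul_mul_smul_comm, Complex.ofReal_mul, mul_comm (_ : ℂ)]
  rw [e]
  simp only [h, smul_ite, smul_zero, Finset.sum_ite_eq, Finset.mem_univ, if_true,
    smul_smul, ← Finset.sum_smul]
  congr 1
  push_cast
  rw [Finset.mul_sum]
  exact Finset.sum_congr rfl fun a _ => by ring

lemma mul_self_eq_of_add_self {x : A} {r : ℝ} (h : x * x + x * x = ((2 * r : ℝ) : ℂ) • 1) :
    x * x = (r : ℂ) • 1 := by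
  rw [← two_smul ℂ, Complex.ofReal_mul, mul_smul] at h
  refine smul_right_injective _ (two_ne_zero (α := ℂ)) ?_
  simpa using h

lemma smul_mul_self_eq_one {x : A} {r : ℝ} (hr : r * r = 1) (h : x * x = (r : ℂ) • 1) :
    ((r : ℂ) • x) * x = 1 := by
  rw [smul_mul_assoc, h, smul_smul, ← Complex.ofReal_mul, hr]
  simp

lemma eq_zero_of_ofReal_smul_one [Nontrivial A] {r : ℝ} (h : ((2 * r : ℝ) : ℂ) • (1 : A) = 0) :
    r = 0 := by
  rw [smul_eq_zero_iff_left one_ne_zero] at h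
  have : 2 * r = 0 := by exact_mod_cast h
  linarith

/-- Meant for `t` anti-Hermitian and `y` Hermitian, where the right side is the adjoint of the left:
a Hermitian sum has no `t` component. -/
lemma eq_zero_of_neg_smul_add_eq {t y : A} {r : ℝ} (h : (r : ℂ) • t + y = -((r : ℂ) • t) + y) :
    r = 0 ∨ t = 0 := by
  rw [add_left_inj, eq_neg_iff_add_eq_zero, ← two_smul ℂ, smul_eq_zero, smul_eq_zero] at h
  simpa using h

/-- Same setting, with the adjoint equal to minus the sum: an anti-Hermitian sum has no Hermitian
part. -/
lemma eq_zero_of_neg_smul_add_eq_neg {t y : A} {r : ℝ}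
    (h : -((r : ℂ) • t + y) = -((r : ℂ) • t) + y) : y = 0 := by
  rw [neg_add, add_right_inj, eq_comm, eq_neg_iff_add_eq_zero, ← two_smul ℂ, smul_eq_zero] at h
  exact h.resolve_left two_ne_zero

end Algebra

section StarAlgebra

lemma star_mul_mul_mul_self {A : Type*} [Ring A] [StarRing A] {s t : A} (hs : star s * s = 1)
    (ht : star t * t = 1) : star (s * t) * (s * t) = 1 := by
  rw [star_mul, mul_assoc, ← mul_assoc (star s), hs, one_mul, ht]

variable {A : Type*} [Ring A] [StarRing A] [Algebra ℂ A]

/-- If `t` is skew-adjoint and invertible, `t y` is self-adjoint and `t`, `y` anticommute, then `y`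
is self-adjoint. -/
lemma isSelfAdjoint_of_anticommute {t y : A} {r : ℝ} (hr : r ≠ 0) (ht : star t = -t)
    (htt : t * t = (r : ℂ) • 1) (hty : IsSelfAdjoint (t * y)) {q : ℝ} (hq : q = 0)
    (h : t * y + y * t = ((2 * q : ℝ) : ℂ) • 1) : IsSelfAdjoint y := by
  rw [hq, mul_zero, Complex.ofReal_zero, zero_smul] at h
  have h1 := hty.star_eq
  rw [star_mul, ht, mul_neg] at h1
  have h3 : star y * t = y * t := by
    rw [← neg_inj, h1, ← sub_eq_zero, sub_neg_eq_add, h]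
  -- One more factor `t` on the right turns `t` into the nonzero scalar `r`, which cancels.
  have h4 : star y * (t * t) = y * (t * t) := by
    rw [← mul_assoc, h3, mul_assoc]
  rw [htt, mul_smul_comm, mul_smul_comm, mul_one, mul_one] at h4
  have hr' : (r : ℂ) ≠ 0 := by exact_mod_cast hr
  exact smul_right_injective _ hr' h4

variable [StarModule ℂ A]

lemma star_sum_ofReal_smul {n : ℕ} {γ : Fin n → A} {η : Fin n → ℝ}
    (h : ∀ a, star (γ a) = ((η a : ℝ) : ℂ) • γ a) (v : Fin n → ℝ) :
    star (∑ a, ((v a : ℝ) : ℂ) • γ a) = ∑ a, ((η a * v a : ℝ) : ℂ) • γ a := by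
  simp only [star_sum, star_smul, h, smul_smul]
  refine Finset.sum_congr rfl fun a _ => ?_
  congr 1
  simp [mul_comm]

lemma star_smul_add {t y : A} (r : ℝ) (ht : star t = -t) (hy : IsSelfAdjoint y) :
    star ((r : ℂ) • t + y) = -((r : ℂ) • t) + y := by
  rw [star_add, hy.star_eq, star_smul, ht]
  simp

end StarAlgebra

section Hilbert

variable {V : Type*} [NormedAddCommGroup V] [InnerProductSpace ℂ V] [CompleteSpace V]

lemma inner_map_map_of_star_mul_self {s : V →L[ℂ] V} (hs : star s * s = 1) (a b : V) :
    ⟪s a, s b⟫_ℂ = ⟪a, b⟫_ℂ := by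
  rw [← ContinuousLinearMap.adjoint_inner_right, ← ContinuousLinearMap.star_eq_adjoint,
    ← mul_apply_eq_comp, hs, one_apply_eq_self]

/-- ⟪Bs, Bs⟫ = ⟪s, B*Bs⟫. This is how signs of the inverse metric are read off from norms of
spinors. -/
lemma norm_sq_of_star_mul_self {B : V →L[ℂ] V} {r : ℝ} (h : star B * B = (r : ℂ) • 1) (s : V) :
    ‖B s‖ ^ 2 = r * ‖s‖ ^ 2 := by
  have e1 : ⟪B s, B s⟫_ℂ = ((r : ℝ) : ℂ) * ⟪s, s⟫_ℂ := by
    rw [← ContinuousLinearMap.adjoint_inner_right, ← ContinuousLinearMap.star_eq_adjoint,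
      ← mul_apply_eq_comp, h]
    exact inner_smul_right _ _ _
  rw [inner_self_eq_norm_sq_to_K, inner_self_eq_norm_sq_to_K] at e1
  have e2 : ((‖B s‖ ^ 2 : ℝ) : ℂ) = ((r * ‖s‖ ^ 2 : ℝ) : ℂ) := by
    push_cast
    exact e1
  exact Complex.ofReal_injective e2

end Hilbert

namespace GammaMatrices

variable {n : ℕ} (G : GammaMatrices n)

lemma cliff_add (v w : Fin n → ℝ) : G.cliff (v + w) = G.cliff v + G.cliff w :=
  sum_ofReal_smul_add _ v w

lemma cliff_smul (r : ℝ) (v : Fin n → ℝ) : G.cliff (r • v) = (r : ℂ) • G.cliff v :=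
  sum_ofReal_smul_smul _ r v

lemma cliff_mul_add_cliff_mul (v w : Fin n → ℝ) :
    G.cliff v * G.cliff w + G.cliff w * G.cliff v =
      ((2 * ∑ a, G.η a * v a * w a : ℝ) : ℂ) • 1 :=
  sum_ofReal_smul_mul_add G.clifford v w

lemma star_cliff (v : Fin n → ℝ) : star (G.cliff v) = G.cliff fun a => G.η a * v a :=
  star_sum_ofReal_smul G.adjoint v

/-- A spacelike unit vector acts as a Hermitian operator of square 1, a timelike one as an
anti-Hermitian operator of square -1; both are isometric. -/
lemma IsUnitVector.star_cliff_mul_self {G : GammaMatrices n} {v : Fin n → ℝ}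
    (hv : G.IsUnitVector v) : star (G.cliff v) * G.cliff v = 1 := by
  -- Both cases at once: `r` is the common sign of the metric on the support of `v`.
  have key : ∀ r : ℝ, r * r = 1 → (∀ a, v a ≠ 0 → G.η a = r) →
      star (G.cliff v) * G.cliff v = 1 := by
    intro r hr h
    have e : (fun a => G.η a * v a) = r • v := by
      ext a
      by_cases ha : v a = 0
      · simp [ha]
      · simp [h a ha]
    have s : ∑ a, G.η a * v a * v a = r := by
      rw [← mul_one r, ← hv.1, Finset.mul_sum]
      refine Finset.sum_congr rfl fun a _ => ?_
      by_cases ha : v a = 0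
      · simp [ha]
      · rw [h a ha]; ring
    have c := G.cliff_mul_add_cliff_mul v v
    rw [s] at c
    rw [star_cliff, e, cliff_smul]
    exact smul_mul_self_eq_one hr (mul_self_eq_of_add_self c)
  rcases hv.2 with h | h
  · exact key 1 (by norm_num) h
  · exact key (-1) (by norm_num) h

lemma star_mul_self_of_mem_spinGroup {s : SpinorSpace n →L[ℂ] SpinorSpace n}
    (hs : s ∈ G.spinGroup) : star s * s = 1 := by
  induction hs using Submonoid.closure_induction with
  | mem s hs =>
    obtain ⟨v, w, hv, hw, rfl⟩ := hs
    exact star_mul_mul_mul_self hv.star_cliff_mul_self hw.star_cliff_mul_self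
  | one => simp
  | mul s t _ _ hs ht => exact star_mul_mul_mul_self hs ht

lemma inner_of_mem_spinGroup {s : SpinorSpace n →L[ℂ] SpinorSpace n}
    (hs : s ∈ G.spinGroup) (a b : SpinorSpace n) : ⟪s a, s b⟫_ℂ = ⟪a, b⟫_ℂ :=
  inner_map_map_of_star_mul_self (G.star_mul_self_of_mem_spinGroup hs) a b

end GammaMatrices

variable {n : ℕ} {M : Type*} [TopologicalSpace M] [ChartedSpace (EuclideanSpace ℝ (Fin n)) M]
  [IsManifold (𝓡 n) ∞ M]

/-! ### The inverse metric, and Clifford multiplication in adapted frames. -/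

namespace PseudoRiemannianMetric

variable (g : PseudoRiemannianMetric n M)

lemma sharp_add (x : M) (ξ ζ : TangentSpace (𝓡 n) x →L[ℝ] ℝ) :
    g.sharp x (ξ + ζ) = g.sharp x ξ + g.sharp x ζ := by
  rw [← sub_eq_zero]
  refine g.nondegenerate x _ fun w => ?_
  simp [sharp_spec]

lemma sharp_smul (x : M) (r : ℝ) (ξ : TangentSpace (𝓡 n) x →L[ℝ] ℝ) :
    g.sharp x (r • ξ) = r • g.sharp x ξ := by
  rw [← sub_eq_zero]
  refine g.nondegenerate x _ fun w => ?_
  simp [sharp_spec]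

lemma sharp_val (x : M) (v : TangentSpace (𝓡 n) x) : g.sharp x (g.val x v) = v := by
  rw [← sub_eq_zero]
  refine g.nondegenerate x _ fun w => ?_
  simp [sharp_spec]

lemma cometric_eq_val_sharp (x : M) (ξ ζ : TangentSpace (𝓡 n) x →L[ℝ] ℝ) :
    g.cometric x ξ ζ = g.val x (g.sharp x ξ) (g.sharp x ζ) := by
  rw [sharp_spec, cometric]

lemma cometric_add_right (x : M) (τ ξ ζ : TangentSpace (𝓡 n) x →L[ℝ] ℝ) :
    g.cometric x τ (ξ + ζ) = g.cometric x τ ξ + g.cometric x τ ζ := by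
  simp [cometric, sharp_add]

lemma cometric_smul_right (x : M) (r : ℝ) (τ ξ : TangentSpace (𝓡 n) x →L[ℝ] ℝ) :
    g.cometric x τ (r • ξ) = r * g.cometric x τ ξ := by
  simp [cometric, sharp_smul]

end PseudoRiemannianMetric

namespace SpinStructure

variable {g : PseudoRiemannianMetric n M} (S : SpinStructure g)

lemma η_mul_self (a : Fin n) : S.gam.η a * S.gam.η a = 1 := by
  rcases S.gam.η_sign a with h | h <;> simp [h]

lemma val_sum_smul_frame {i : S.ι} {x : M} (hx : x ∈ S.U i) (r : Fin n → ℝ) (b : Fin n) :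
    g.val x (∑ a, r a • S.E i a x) (S.E i b x) = r b * S.gam.η b := by
  simp only [map_sum, map_smul, sum_apply, smul_apply,
    S.E_orthonormal i x hx, smul_eq_mul, mul_ite, mul_zero]
  simp

/-- Pairing a vanishing combination with each frame vector isolates its coefficient up to sign, so
the n frame vectors are independent. -/
lemma span_frame {i : S.ι} {x : M} (hx : x ∈ S.U i) :
    Submodule.span ℝ (Set.range fun a => S.E i a x) = ⊤ := by
  have hfin : FiniteDimensional ℝ (TangentSpace (𝓡 n) x) :=
    inferInstanceAs (FiniteDimensional ℝ (EuclideanSpace ℝ (Fin n)))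
  refine LinearIndependent.span_eq_top_of_card_eq_finrank' ?_ ?_
  · rw [Fintype.linearIndependent_iff]
    intro r hr b
    have h := S.val_sum_smul_frame hx r b
    rw [hr] at h
    have h0 := S.η_mul_self b
    have h1 : r b * S.gam.η b = 0 := by simpa using h.symm
    rcases mul_eq_zero.1 h1 with h2 | h2
    · exact h2
    · simp [h2] at h0
  · exact (finrank_euclideanSpace (𝕜 := ℝ) (ι := Fin n)).symm

lemma sharp_eq_sum {i : S.ι} {x : M} (hx : x ∈ S.U i) (ζ : TangentSpace (𝓡 n) x →L[ℝ] ℝ) :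
    g.sharp x ζ = ∑ a, (S.gam.η a * ζ (S.E i a x)) • S.E i a x := by
  rw [← sub_eq_zero]
  refine g.nondegenerate x _ fun w => ?_
  have hw : w ∈ Submodule.span ℝ (Set.range fun a => S.E i a x) := by
    rw [S.span_frame hx]; trivial
  induction hw using Submodule.span_induction with
  | mem w hw =>
    obtain ⟨b, rfl⟩ := hw
    have h := S.val_sum_smul_frame hx (fun a => S.gam.η a * ζ (S.E i a x)) b
    have e := S.η_mul_self b
    simp only [map_sub, sub_apply, g.sharp_spec]
    rw [h, sub_eq_zero]
    linear_combination (-ζ (S.E i b x)) * e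
  | zero => simp
  | add v w _ _ hv hw => rw [map_add, hv, hw, add_zero]
  | smul r v _ hv => rw [map_smul, hv, smul_zero]

/-- Identifies the abstract inverse metric with the sum in the Clifford relations, whence c(ξ)² =
g⁻¹(ξ,ξ). -/
lemma cometric_eq_sum {i : S.ι} {x : M} (hx : x ∈ S.U i)
    (ξ ζ : TangentSpace (𝓡 n) x →L[ℝ] ℝ) :
    g.cometric x ξ ζ = ∑ a, S.gam.η a * ξ (S.E i a x) * ζ (S.E i a x) := by
  rw [PseudoRiemannianMetric.cometric, S.sharp_eq_sum hx, map_sum]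
  refine Finset.sum_congr rfl fun a _ => ?_
  rw [map_smul, smul_eq_mul]
  ring

lemma c_add (i : S.ι) (x : M) (ξ ζ : TangentSpace (𝓡 n) x →L[ℝ] ℝ) :
    S.c i x (ξ + ζ) = S.c i x ξ + S.c i x ζ :=
  S.gam.cliff_add _ _

lemma c_smul (i : S.ι) (x : M) (r : ℝ) (ξ : TangentSpace (𝓡 n) x →L[ℝ] ℝ) :
    S.c i x (r • ξ) = (r : ℂ) • S.c i x ξ :=
  S.gam.cliff_smul r _

lemma c_mul_add_c_mul {i : S.ι} {x : M} (hx : x ∈ S.U i)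
    (ξ ζ : TangentSpace (𝓡 n) x →L[ℝ] ℝ) :
    S.c i x ξ * S.c i x ζ + S.c i x ζ * S.c i x ξ = ((2 * g.cometric x ξ ζ : ℝ) : ℂ) • 1 := by
  rw [S.cometric_eq_sum hx]
  exact S.gam.cliff_mul_add_cliff_mul _ _

lemma c_mul_self {i : S.ι} {x : M} (hx : x ∈ S.U i) (ξ : TangentSpace (𝓡 n) x →L[ℝ] ℝ) :
    S.c i x ξ * S.c i x ξ = ((g.cometric x ξ ξ : ℝ) : ℂ) • 1 := by
  exact mul_self_eq_of_add_self (S.c_mul_add_c_mul hx ξ ξ)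

/-- Nonzero spinors exist, so a scalar operator determines its scalar. -/
instance : Nonempty (Fin (2 ^ (n / 2))) := ⟨⟨0, by positivity⟩⟩

/-- The anticommutators of c(ξ) with all c(ζ) recover g⁻¹(ξ, ·), which is nondegenerate. -/
lemma eq_zero_of_c_eq_zero {i : S.ι} {x : M} (hx : x ∈ S.U i)
    {ξ : TangentSpace (𝓡 n) x →L[ℝ] ℝ} (h : S.c i x ξ = 0) : ξ = 0 := by
  have h0 : ∀ ζ, g.cometric x ξ ζ = 0 := by
    intro ζ
    have e := S.c_mul_add_c_mul hx ξ ζ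
    rw [h, zero_mul, mul_zero, add_zero] at e
    exact eq_zero_of_ofReal_smul_one e.symm
  ext w
  rw [← g.sharp_val x w]
  exact h0 _

/-- For Hermitian c(ξ), the scalar c(ξ)² = c(ξ)*c(ξ) is nonnegative, and c(ξ) = 0 when it vanishes.
-/
lemma cometric_nonneg_of_isSelfAdjoint {i : S.ι} {x : M} (hx : x ∈ S.U i)
    {ξ : TangentSpace (𝓡 n) x →L[ℝ] ℝ} (h : IsSelfAdjoint (S.c i x ξ)) :
    0 ≤ g.cometric x ξ ξ ∧ (g.cometric x ξ ξ = 0 → ξ = 0) := by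
  have key := norm_sq_of_star_mul_self (B := S.c i x ξ) (r := g.cometric x ξ ξ)
    (by rw [h.star_eq, S.c_mul_self hx])
  refine ⟨?_, fun h0 => S.eq_zero_of_c_eq_zero hx ?_⟩
  · obtain ⟨s, hs⟩ := exists_ne (0 : SpinorSpace n)
    by_contra hneg
    have h1 := key s
    have h2 : 0 < ‖s‖ ^ 2 := by positivity
    nlinarith [sq_nonneg ‖S.c i x ξ s‖]
  · ext1 s
    have h1 := key s
    rw [h0, zero_mul] at h1
    simpa using h1

/-- The data which the operators of a temporal spectral triple provide at a point: a timelike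
covector `τ` such that `c(τ)` is anti-Hermitian and all `c(τ) c(ξ)` are Hermitian. -/
structure IsTemporal (i : S.ι) (x : M) (τ : TangentSpace (𝓡 n) x →L[ℝ] ℝ) : Prop where
  mem : x ∈ S.U i
  neg : g.cometric x τ τ < 0
  star_eq : star (S.c i x τ) = -S.c i x τ
  isSelfAdjoint_mul : ∀ ξ, IsSelfAdjoint (S.c i x τ * S.c i x ξ)

namespace IsTemporal

variable {S} {i : S.ι} {x : M} {τ : TangentSpace (𝓡 n) x →L[ℝ] ℝ}

lemma isSelfAdjoint_c (h : S.IsTemporal i x τ) {ξ : TangentSpace (𝓡 n) x →L[ℝ] ℝ}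
    (hξ : g.cometric x τ ξ = 0) : IsSelfAdjoint (S.c i x ξ) := by
  exact isSelfAdjoint_of_anticommute h.neg.ne h.star_eq (S.c_mul_self h.mem τ)
    (h.isSelfAdjoint_mul ξ) hξ (S.c_mul_add_c_mul h.mem τ ξ)

/-- The covector g(w, ·) is orthogonal to τ because τ(w) = 0, so its Clifford action is Hermitian
and its square is g(w, w). -/
lemma val_pos (h : S.IsTemporal i x τ) {w : TangentSpace (𝓡 n) x} (hw : τ w = 0)
    (hw0 : w ≠ 0) : 0 < g.val x w w := by
  have h1 : g.cometric x τ (g.val x w) = 0 := by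
    rw [PseudoRiemannianMetric.cometric, g.sharp_val, hw]
  have h2 := S.cometric_nonneg_of_isSelfAdjoint h.mem (h.isSelfAdjoint_c h1)
  have h3 : g.cometric x (g.val x w) (g.val x w) = g.val x w w := by
    rw [PseudoRiemannianMetric.cometric, g.sharp_val]
  rw [h3] at h2
  refine lt_of_le_of_ne h2.1 fun h4 => hw0 (g.nondegenerate x w fun v => ?_)
  rw [h2.2 h4.symm]
  rfl

lemma star_c (h : S.IsTemporal i x τ) {ζ : TangentSpace (𝓡 n) x →L[ℝ] ℝ}
    (hζ : g.cometric x τ ζ = 0) (r : ℝ) :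
    star (S.c i x (r • τ + ζ)) = -((r : ℂ) • S.c i x τ) + S.c i x ζ := by
  rw [S.c_add, S.c_smul]
  exact star_smul_add r h.star_eq (h.isSelfAdjoint_c hζ)

/-- The decomposition of a covector along `τ` and its orthogonal complement. -/
lemma exists_decomposition (h : S.IsTemporal i x τ) (ξ : TangentSpace (𝓡 n) x →L[ℝ] ℝ) :
    ∃ (r : ℝ) (ζ : TangentSpace (𝓡 n) x →L[ℝ] ℝ), ξ = r • τ + ζ ∧ g.cometric x τ ζ = 0 := by
  refine ⟨g.cometric x τ ξ / g.cometric x τ τ,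
    ξ - (g.cometric x τ ξ / g.cometric x τ τ) • τ, (add_sub_cancel _ _).symm, ?_⟩
  have e : g.cometric x τ ξ = g.cometric x τ ((g.cometric x τ ξ / g.cometric x τ τ) • τ) +
      g.cometric x τ (ξ - (g.cometric x τ ξ / g.cometric x τ τ) • τ) := by
    rw [← g.cometric_add_right, add_sub_cancel]
  rw [g.cometric_smul_right, div_mul_cancel₀ _ h.neg.ne] at e
  linarith

lemma cometric_eq_zero_of_isSelfAdjoint (h : S.IsTemporal i x τ)
    {ξ : TangentSpace (𝓡 n) x →L[ℝ] ℝ} (hξ : IsSelfAdjoint (S.c i x ξ)) :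
    g.cometric x τ ξ = 0 := by
  obtain ⟨r, ζ, rfl, h0⟩ := h.exists_decomposition ξ
  have h1 := h.star_c h0 r
  rw [hξ.star_eq, S.c_add, S.c_smul] at h1
  rcases eq_zero_of_neg_smul_add_eq h1 with h1 | h1
  · rw [g.cometric_add_right, g.cometric_smul_right, h1, h0, zero_mul, add_zero]
  -- c(τ) = 0 would give τ = 0, which is not timelike.
  · have := h.neg
    rw [S.eq_zero_of_c_eq_zero h.mem h1] at this
    simp [PseudoRiemannianMetric.cometric] at this

lemma exists_eq_smul_of_star_eq_neg (h : S.IsTemporal i x τ)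
    {ξ : TangentSpace (𝓡 n) x →L[ℝ] ℝ} (hξ : star (S.c i x ξ) = -S.c i x ξ) :
    ∃ r : ℝ, ξ = r • τ := by
  obtain ⟨r, ζ, rfl, h0⟩ := h.exists_decomposition ξ
  have h1 := h.star_c h0 r
  rw [hξ, S.c_add, S.c_smul] at h1
  exact ⟨r, by
    rw [S.eq_zero_of_c_eq_zero h.mem (eq_zero_of_neg_smul_add_eq_neg h1), add_zero]⟩

end IsTemporal

end SpinStructure

end

/-! ### The density of the metric, and localisation of integral inequalities. -/

section

open MeasureTheory

variable {n : ℕ} {M : Type*} [TopologicalSpace M] [ChartedSpace (EuclideanSpace ℝ (Fin n)) M]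

/-- If h(x) < 0, a bump function at x supported in {h < 0} makes the integral negative. The square
arises from inserting ρ in both arguments of a sesquilinear form. -/
lemma nonneg_of_integral_sq_mul_nonneg [T2Space M] [IsManifold (𝓡 n) ∞ M]
    [MeasurableSpace M] [BorelSpace M]
    (m : Measure M) [IsLocallyFiniteMeasure m] [m.IsOpenPosMeasure] {h : M → ℝ}
    (hc : Continuous h)
    (H : ∀ ρ : M → ℝ, ContMDiff (𝓡 n) 𝓘(ℝ, ℝ) ∞ ρ → 0 ≤ ∫ x, ρ x ^ 2 * h x ∂m) (x : M) :
    0 ≤ h x := by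
  by_contra! hx
  obtain ⟨ρ, -, hρ⟩ := (SmoothBumpFunction.nhds_basis_tsupport (I := 𝓡 n) x).mem_iff.1
    ((isOpen_lt hc continuous_const).mem_nhds hx)
  have h1 : 0 < ∫ y, -(ρ y ^ 2 * h y) ∂m := by
    refine Continuous.integral_pos_of_hasCompactSupport_nonneg_nonzero (x := x)
      ((ρ.continuous.pow 2).mul hc).neg ?_ ?_ ?_
    · refine ρ.hasCompactSupport.mono' fun y hy => subset_closure ?_
      intro h0
      simp [h0] at hy
    · intro y
      by_cases hy : ρ y = 0
      · simp [hy]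
      · have : h y < 0 := hρ (subset_closure hy)
        have := mul_nonneg (sq_nonneg (ρ y)) (neg_nonneg.2 this.le)
        simpa using this
    · simpa using hx.ne
  rw [integral_neg] at h1
  linarith [H ρ ρ.contMDiff]

lemma mdifferentiable_of_mem_maximalAtlas {e : OpenPartialHomeomorph M (EuclideanSpace ℝ (Fin n))}
    (he : e ∈ IsManifold.maximalAtlas (𝓡 n) ∞ M) : e.MDifferentiable (𝓡 n) (𝓡 n) :=
  ⟨(contMDiffOn_of_mem_maximalAtlas he).mdifferentiableOn (by simp),
    (contMDiffOn_symm_of_mem_maximalAtlas he).mdifferentiableOn (by simp)⟩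

variable [IsManifold (𝓡 n) ∞ M]

lemma contMDiffOn_coordVec {e : OpenPartialHomeomorph M (EuclideanSpace ℝ (Fin n))}
    (he : e ∈ IsManifold.maximalAtlas (𝓡 n) ∞ M) (μ : Fin n) :
    ContMDiffOn (𝓡 n) (𝓡 n).tangent ∞
      (fun y => (⟨e.symm y, coordVec e μ y⟩ : TangentBundle (𝓡 n) M)) e.target := by
  have h1 := (contMDiffOn_symm_of_mem_maximalAtlas he).contMDiffOn_tangentMapWithin
    (m := ∞) (by simp) e.open_target.uniqueMDiffOn
  have h2 : ContMDiff (𝓡 n) (𝓡 n).tangent ∞ (fun y => (⟨y, EuclideanSpace.single μ (1 : ℝ)⟩ :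
      TangentBundle (𝓡 n) (EuclideanSpace ℝ (Fin n)))) := by
    intro y
    exact contMDiffAt_vectorSpace_iff_contDiffAt.2 contDiffAt_const
  refine (h1.comp h2.contMDiffOn fun y hy => hy).congr fun y hy => ?_
  simp only [Function.comp_def, tangentMapWithin, coordVec]
  rw [mfderivWithin_of_isOpen e.open_target hy]

namespace PseudoRiemannianMetric

variable (g : PseudoRiemannianMetric n M)

/-- The vector fields lie along a map `b`, so that coordinate vectors over the target of a chart are
covered. -/
lemma contMDiffWithinAt_val {N : Type*} [TopologicalSpace N]
    [ChartedSpace (EuclideanSpace ℝ (Fin n)) N] {b : N → M} {s : Set N} {y : N}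
    {v w : (y : N) → TangentSpace (𝓡 n) (b y)}
    (hv : ContMDiffWithinAt (𝓡 n) (𝓡 n).tangent ∞
      (fun y => (⟨b y, v y⟩ : TangentBundle (𝓡 n) M)) s y)
    (hw : ContMDiffWithinAt (𝓡 n) (𝓡 n).tangent ∞
      (fun y => (⟨b y, w y⟩ : TangentBundle (𝓡 n) M)) s y) :
    ContMDiffWithinAt (𝓡 n) 𝓘(ℝ, ℝ) ∞ (fun y => g.val (b y) (v y) (w y)) s y := by
  have hb : ContMDiffWithinAt (𝓡 n) (𝓡 n) ∞ b s y :=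
    (Bundle.contMDiffWithinAt_totalSpace.1 hv).1
  have h := ContMDiffWithinAt.clm_bundle_apply₂ (F₁ := EuclideanSpace ℝ (Fin n))
    (F₂ := EuclideanSpace ℝ (Fin n)) (F₃ := ℝ) (E₃ := Bundle.Trivial M ℝ)
    ((g.smooth (b y)).comp_contMDiffWithinAt y hb) hv hw
  exact (Bundle.contMDiffWithinAt_totalSpace.1 h).2

variable {e : OpenPartialHomeomorph M (EuclideanSpace ℝ (Fin n))}

lemma continuousOn_coordDet (he : e ∈ IsManifold.maximalAtlas (𝓡 n) ∞ M) :
    ContinuousOn (g.coordDet e) e.target := by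
  rw [continuousOn_iff_continuous_domRestrict]
  refine Continuous.matrix_det (continuous_matrix fun μ ν => ?_)
  have h : ContinuousOn (fun y => g.val (e.symm y) (coordVec e μ y) (coordVec e ν y)) e.target :=
    fun y hy => (g.contMDiffWithinAt_val (contMDiffOn_coordVec he μ y hy)
      (contMDiffOn_coordVec he ν y hy)).continuousWithinAt
  exact continuousOn_iff_continuous_domRestrict.1 h

/-- A kernel vector of the Gram matrix gives a vector orthogonal to all ∂_μ, which span the tangent
space. -/
lemma coordDet_ne_zero (he : e ∈ IsManifold.maximalAtlas (𝓡 n) ∞ M)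
    {y : EuclideanSpace ℝ (Fin n)} (hy : y ∈ e.target) : g.coordDet e y ≠ 0 := by
  intro h0
  obtain ⟨r, hr, h⟩ := Matrix.exists_mulVec_eq_zero_iff.2 h0
  set L := mfderiv (𝓡 n) (𝓡 n) e.symm y
  have hL := (mdifferentiable_of_mem_maximalAtlas he).symm.mfderiv_bijective hy
  have hsum : ∀ t : EuclideanSpace ℝ (Fin n),
      L t = ∑ μ, t μ • coordVec e μ y := by
    intro t
    have ht : t = ∑ i, t i • EuclideanSpace.single i (1 : ℝ) := by
      simpa using ((EuclideanSpace.basisFun (Fin n) ℝ).sum_repr t).symm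
    exact (congrArg L ht).trans ((map_sum L _ _).trans
      (Finset.sum_congr rfl fun μ _ => map_smul L (t μ) _))
  refine hr ?_
  have hv : L (WithLp.toLp 2 r) = 0 := by
    refine g.nondegenerate _ _ fun w => ?_
    obtain ⟨t, rfl⟩ := hL.2 w
    rw [g.symm]
    change g.val (e.symm y) (L t) (L (WithLp.toLp 2 r)) = 0
    rw [hsum t, map_sum, sum_apply]
    refine Finset.sum_eq_zero fun μ _ => ?_
    rw [map_smul, smul_apply, hsum, map_sum]
    have h1 := congrFun h μ
    simp only [Matrix.mulVec, dotProduct, Matrix.of_apply, Pi.zero_apply] at h1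
    simp only [map_smul, smul_eq_mul, mul_comm (r _)]
    rw [h1, mul_zero]
  have h2 := hL.1 (hv.trans (map_zero L).symm)
  funext μ
  exact congrFun (congrArg WithLp.ofLp h2) μ

variable {g} [MeasurableSpace M] [BorelSpace M] {m : Measure M}

/-- The continuous density √|det g| is bounded on compact subsets of a chart. -/
lemma IsVolume.isLocallyFiniteMeasure (hm : g.IsVolume m) : IsLocallyFiniteMeasure m := by
  refine ⟨fun x => ?_⟩
  set e := chartAt (EuclideanSpace ℝ (Fin n)) x
  have he : e ∈ IsManifold.maximalAtlas (𝓡 n) ∞ M := IsManifold.chart_mem_maximalAtlas x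
  have hx : x ∈ e.source := mem_chart_source _ x
  obtain ⟨K, hK, hxK, hKe⟩ := exists_compact_subset e.open_target (e.map_source hx)
  have hs : IsOpen (e.source ∩ e ⁻¹' interior K) := e.isOpen_inter_preimage isOpen_interior
  refine ⟨_, hs.mem_nhds ⟨hx, hxK⟩, ?_⟩
  rw [hm e he _ Set.inter_subset_left hs.measurableSet]
  have hsub : e '' (e.source ∩ e ⁻¹' interior K) ⊆ K := by
    rintro _ ⟨z, hz, rfl⟩
    exact interior_subset hz.2
  obtain ⟨C, hC⟩ := hK.exists_bound_of_continuousOn ((g.continuousOn_coordDet he).mono hKe)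
  calc ∫⁻ y in e '' (e.source ∩ e ⁻¹' interior K), ENNReal.ofReal (√|g.coordDet e y|)
      ≤ ∫⁻ y in K, ENNReal.ofReal (√|g.coordDet e y|) := lintegral_mono_set hsub
    _ ≤ ∫⁻ _ in K, ENNReal.ofReal (√C) := setLIntegral_mono' hK.measurableSet fun y hy =>
        ENNReal.ofReal_le_ofReal (Real.sqrt_le_sqrt (hC y hy))
    _ < ⊤ := by
        rw [setLIntegral_const]
        exact ENNReal.mul_lt_top ENNReal.ofReal_lt_top hK.measure_lt_top

/-- On a nonempty null open set the density would vanish almost everywhere, yet it is positive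
throughout each chart. -/
lemma IsVolume.isOpenPosMeasure (hm : g.IsVolume m) : m.IsOpenPosMeasure := by
  refine ⟨fun U hU ⟨x, hx⟩ h0 => ?_⟩
  set e := chartAt (EuclideanSpace ℝ (Fin n)) x
  have he : e ∈ IsManifold.maximalAtlas (𝓡 n) ∞ M := IsManifold.chart_mem_maximalAtlas x
  have hxe : x ∈ e.source := mem_chart_source _ x
  have hs : IsOpen (U ∩ e.source) := hU.inter e.open_source
  have ht : IsOpen (e '' (U ∩ e.source)) :=
    e.isOpen_image_of_subset_source hs Set.inter_subset_right
  have hte : e '' (U ∩ e.source) ⊆ e.target := by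
    rintro _ ⟨z, hz, rfl⟩
    exact e.map_source hz.2
  have h1 := hm e he (U ∩ e.source) Set.inter_subset_right hs.measurableSet
  rw [measure_mono_null Set.inter_subset_left h0, eq_comm, lintegral_eq_zero_iff'] at h1
  · rw [Filter.EventuallyEq, ae_restrict_iff' ht.measurableSet] at h1
    refine (ht.measure_pos volume ⟨e x, x, ⟨hx, hxe⟩, rfl⟩).ne' ?_
    refine measure_mono_null (fun y hy => ?_) (ae_iff.1 h1)
    intro h2
    have h2 := h2 hy
    simp only [Pi.zero_apply, ENNReal.ofReal_eq_zero, not_le.2 (Real.sqrt_pos.2 (abs_pos.2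
      (g.coordDet_ne_zero he (hte hy))))] at h2
  · refine ContinuousOn.aemeasurable ?_ ht.measurableSet
    exact (ENNReal.continuous_ofReal.comp (Real.continuous_sqrt.comp
      continuous_abs)).comp_continuousOn ((g.continuousOn_coordDet he).mono hte)

end PseudoRiemannianMetric

end

/-! ### Test spinors and the Leibniz rule for the Dirac operator. -/

section

section Functions

variable {n : ℕ} {M : Type*} [TopologicalSpace M] [ChartedSpace (EuclideanSpace ℝ (Fin n)) M]

lemma contMDiff_ofReal_comp {f : M → ℝ} (hf : ContMDiff (𝓡 n) 𝓘(ℝ, ℝ) ∞ f) :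
    ContMDiff (𝓡 n) 𝓘(ℝ, ℂ) ∞ fun x => (f x : ℂ) :=
  Complex.ofRealCLM.contDiff.contMDiff.comp hf

lemma contMDiff_of_ofReal_comp {f : M → ℝ}
    (hf : ContMDiff (𝓡 n) 𝓘(ℝ, ℂ) ∞ fun x => (f x : ℂ)) : ContMDiff (𝓡 n) 𝓘(ℝ, ℝ) ∞ f :=
  Complex.reCLM.contDiff.contMDiff.comp hf

lemma SpinStructure.spinorDeriv_smul {f : M → ℝ} {ψ : M → SpinorSpace n} {x : M}
    (hf : MDifferentiableAt (𝓡 n) 𝓘(ℝ, ℝ) f x)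
    (hψ : MDifferentiableAt (𝓡 n) 𝓘(ℝ, SpinorSpace n) ψ x) (v : TangentSpace (𝓡 n) x) :
    SpinStructure.spinorDeriv (fun y => (f y : ℂ) • ψ y) x v =
      ((f x : ℝ) : ℂ) • SpinStructure.spinorDeriv ψ x v + ((differential f x v : ℝ) : ℂ) • ψ x := by
  have h1 := hf.hasMFDerivAt
  have h2 := hψ.hasMFDerivAt
  have h3 : HasMFDerivAt (𝓡 n) 𝓘(ℝ, SpinorSpace n) (fun y => (f y : ℂ) • ψ y) x _ :=
    ⟨(Complex.continuous_ofReal.continuousAt.comp h1.1).smul h2.1,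
      (Complex.ofRealCLM.hasFDerivAt.comp_hasFDerivWithinAt _ h1.2).smul h2.2⟩
  rw [SpinStructure.spinorDeriv, h3.mfderiv]
  simp only [writtenInExtChartAt, Function.comp_apply, mfld_simps]
  rfl

variable [IsManifold (𝓡 n) ∞ M]

lemma exists_differential_eq [T2Space M] (x : M) (ξ : TangentSpace (𝓡 n) x →L[ℝ] ℝ) :
    ∃ f : M → ℝ, ContMDiff (𝓡 n) 𝓘(ℝ, ℝ) ∞ f ∧ differential f x = ξ := by
  let ρ : SmoothBumpFunction (𝓡 n) x := Classical.arbitrary _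
  let ξ' : EuclideanSpace ℝ (Fin n) →L[ℝ] ℝ := ξ
  -- The linear function ξ in the preferred chart at x, cut off. The tangent space at x is modelled
  -- through this same chart, so the differential is ξ itself.
  refine ⟨fun y => ρ y • ξ' (extChartAt (𝓡 n) x y), ?_, ?_⟩
  · refine ρ.contMDiff_smul ?_
    exact ξ'.contDiff.contMDiff.comp_contMDiffOn (contMDiffOn_extChartAt)
  · have h1 : (fun y => ρ y • ξ' (extChartAt (𝓡 n) x y)) =ᶠ[𝓝 x]
        fun y => ξ' (extChartAt (𝓡 n) x y) := by
      filter_upwards [ρ.eventuallyEq_one] with y hy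
      simp [hy]
    have h2 : HasMFDerivAt (𝓡 n) 𝓘(ℝ, ℝ) (fun y => ξ' (extChartAt (𝓡 n) x y)) x ξ := by
      refine ⟨ξ'.continuous.continuousAt.comp (continuousAt_extChartAt x), ?_⟩
      refine ξ'.hasFDerivAt.hasFDerivWithinAt.congr_of_eventuallyEq ?_
        (by simp only [mfld_simps]; rfl)
      filter_upwards [extChartAt_target_mem_nhdsWithin x] with y hy
      simp only [writtenInExtChartAt, Function.comp_apply, extChartAt_model_space_eq_id,
        PartialEquiv.refl_coe, id]
      rw [(extChartAt (𝓡 n) x).right_inv hy]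
    rw [differential, h1.mfderiv_eq, h2.mfderiv]

end Functions

section Vector

variable {V : Type*} [NormedAddCommGroup V] [NormedSpace ℂ V] {n : ℕ}

/-- The Leibniz rule passes from the derivative to the spin connection, since the connection term is
linear over functions. -/
lemma add_sum_clm_smul (γ : Fin n → V →L[ℂ] V) (κ : Fin n → Fin n → ℂ) {d d' p : V} {z w : ℂ}
    (h : d' = z • d + w • p) :
    d' + (1 / 4 : ℂ) • ∑ b, ∑ c, κ b c • γ b (γ c (z • p)) =
      z • (d + (1 / 4 : ℂ) • ∑ b, ∑ c, κ b c • γ b (γ c p)) + w • p := by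
  simp only [h, map_smul, smul_add, Finset.smul_sum, smul_comm z]
  abel

/-- In the commutator with a function the differentiated spinors cancel and only the symbol remains.
-/
lemma sum_clm_sub_smul (γ : Fin n → V →L[ℂ] V) {N N' : Fin n → V} {p : V} {z : ℂ}
    {w : Fin n → ℂ} (h : ∀ a, N' a = z • N a + w a • p) :
    (-Complex.I) • ∑ a, γ a (N' a) - z • (-Complex.I) • ∑ a, γ a (N a) =
      (-Complex.I) • (∑ a, w a • γ a) p := by
  simp only [h, map_add, map_smul, Finset.sum_add_distrib, smul_add, ← Finset.smul_sum,
    smul_comm z, sum_apply, smul_apply]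
  abel

end Vector

variable {n : ℕ} {M : Type*} [TopologicalSpace M] [ChartedSpace (EuclideanSpace ℝ (Fin n)) M]
  [IsManifold (𝓡 n) ∞ M]

namespace SpinStructure

variable {g : PseudoRiemannianMetric n M} (S : SpinStructure g)

lemma pointwiseInner_eq (ψ φ : S.testSpinors) {i : S.ι} {x : M} (hx : x ∈ S.U i) :
    S.pointwiseInner ψ.1 φ.1 x = ⟪ψ.1 i x, φ.1 i x⟫_ℂ := by
  have hj := (S.cover x).choose_spec
  rw [pointwiseInner, ψ.2.2.1 _ i x ⟨hj, hx⟩, φ.2.2.1 _ i x ⟨hj, hx⟩]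
  exact S.gam.inner_of_mem_spinGroup (S.lam_mem _ i x ⟨hj, hx⟩) _ _

lemma testSpinors_ext {ψ φ : S.testSpinors} (h : ∀ i, ∀ x ∈ S.U i, ψ.1 i x = φ.1 i x) :
    ψ = φ := by
  refine Subtype.ext (funext fun i => funext fun x => ?_)
  by_cases hx : x ∈ S.U i
  · exact h i x hx
  · rw [ψ.2.1 i x hx, φ.2.1 i x hx]

lemma continuousAt_testSpinor (ψ : S.testSpinors) {i : S.ι} {x : M} (hx : x ∈ S.U i) :
    ContinuousAt (ψ.1 i) x :=
  ((ψ.2.2.2.1 i).continuousOn).continuousAt ((S.isOpen_U i).mem_nhds hx)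

lemma mdifferentiableAt_testSpinor (ψ : S.testSpinors) {i : S.ι} {x : M} (hx : x ∈ S.U i) :
    MDifferentiableAt (𝓡 n) 𝓘(ℝ, SpinorSpace n) (ψ.1 i) x :=
  ((ψ.2.2.2.1 i).contMDiffAt ((S.isOpen_U i).mem_nhds hx)).mdifferentiableAt (by simp)

lemma continuous_pointwiseInner (ψ φ : S.testSpinors) :
    Continuous (S.pointwiseInner ψ.1 φ.1) := by
  rw [continuous_iff_continuousAt]
  intro x
  obtain ⟨i, hx⟩ := S.cover x
  refine (ContinuousAt.inner (𝕜 := ℂ) (S.continuousAt_testSpinor ψ hx)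
    (S.continuousAt_testSpinor φ hx)).congr ?_
  filter_upwards [(S.isOpen_U i).mem_nhds hx] with y hy
  exact (S.pointwiseInner_eq ψ φ hy).symm

lemma lam_self {i : S.ι} {x : M} (hx : x ∈ S.U i) : S.lam i i x = 1 := by
  -- The cocycle condition makes λ_ii idempotent, and λ*λ = 1 cancels one factor.
  have h1 := S.gam.star_mul_self_of_mem_spinGroup (S.lam_mem i i x ⟨hx, hx⟩)
  rw [← h1]
  conv_lhs => rw [← one_mul (S.lam i i x), ← h1, mul_assoc, S.lam_cocycle i i i x ⟨⟨hx, hx⟩, hx⟩]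

/-- Every spinor at a point is the value of a smooth compactly supported spinor field. -/
lemma exists_testSpinor [T2Space M] {i : S.ι} {x : M} (hx : x ∈ S.U i) (s : SpinorSpace n) :
    ∃ ψ : S.testSpinors, ψ.1 i x = s := by
  classical
  obtain ⟨ρ, -, hρ⟩ := (SmoothBumpFunction.nhds_basis_tsupport (I := 𝓡 n) x).mem_iff.1
    ((S.isOpen_U i).mem_nhds hx)
  have hρ0 : ∀ y ∉ S.U i, ρ y = 0 := fun y hy => by
    by_contra h
    exact hy (hρ (subset_closure h))
  -- The constant spinor `s` of the trivialisation `i`, cut off and carried to the others by λ_ji.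
  -- Outside `U i`, where λ_ji is uncontrolled, the cutoff vanishes in a neighbourhood.
  let ψ : S.ι → M → SpinorSpace n := fun j y =>
    if y ∈ S.U j then ((ρ y : ℝ) : ℂ) • S.lam j i y s else 0
  have hψ : ψ ∈ S.testSpinors := by
    refine ⟨fun j y hy => if_neg hy, fun j k y hy => ?_, fun j y hy => ?_, tsupport ρ,
      ρ.hasCompactSupport, fun j y hy => ?_⟩
    · simp only [ψ, if_pos hy.1, if_pos hy.2]
      rw [map_smul]
      by_cases hi : y ∈ S.U i
      · rw [← S.lam_cocycle j k i y ⟨hy, hi⟩]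
        rfl
      · rw [hρ0 y hi, Complex.ofReal_zero, zero_smul, zero_smul]
    · refine ContMDiffAt.contMDiffWithinAt ?_
      by_cases hi : y ∈ S.U i
      · have hl : ContMDiffAt (𝓡 n) 𝓘(ℝ, SpinorSpace n) ∞ (fun y => S.lam j i y s) y :=
          (((ContinuousLinearMap.apply ℂ (SpinorSpace n) s).restrictScalars
            ℝ).contDiff.contMDiff.comp_contMDiffOn (S.lam_smooth j i)).contMDiffAt
            (((S.isOpen_U j).inter (S.isOpen_U i)).mem_nhds ⟨hy, hi⟩)
        have hsm : ContDiff ℝ ∞ fun p : ℂ × SpinorSpace n => p.1 • p.2 :=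
          contDiff_fst.smul contDiff_snd
        refine (hsm.contMDiff.contMDiffAt.comp y
          ((contMDiff_ofReal_comp ρ.contMDiff y).prodMk_space hl)).congr_of_eventuallyEq ?_
        filter_upwards [(S.isOpen_U j).mem_nhds hy] with z hz
        simp only [ψ, if_pos hz, Function.comp_apply]
      · have h0 : ψ j =ᶠ[𝓝 y] fun _ => 0 := by
          filter_upwards [(isClosed_tsupport ρ).isOpen_compl.mem_nhds fun h => hi (hρ h)]
            with z hz
          have : ρ z = 0 := image_eq_zero_of_notMem_tsupport hz
          simp only [ψ, this, Complex.ofReal_zero, zero_smul, ite_self]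
        exact contMDiffAt_const.congr_of_eventuallyEq h0
    · have : ρ y = 0 := image_eq_zero_of_notMem_tsupport hy
      simp only [ψ, this, Complex.ofReal_zero, zero_smul, ite_self]
  refine ⟨⟨ψ, hψ⟩, ?_⟩
  simp only [ψ, if_pos hx, S.lam_self hx, ρ.eq_one, Complex.ofReal_one, one_smul]
  rfl

section Leibniz

lemma nabla_smul {f : M → ℝ} {ψ : M → SpinorSpace n} {x : M}
    (hf : MDifferentiableAt (𝓡 n) 𝓘(ℝ, ℝ) f x)
    (hψ : MDifferentiableAt (𝓡 n) 𝓘(ℝ, SpinorSpace n) ψ x) (i : S.ι) (a : Fin n) :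
    S.nabla i a (fun y => (f y : ℂ) • ψ y) x =
      ((f x : ℝ) : ℂ) • S.nabla i a ψ x + ((differential f x (S.E i a x) : ℝ) : ℂ) • ψ x :=
  add_sum_clm_smul _ _ (spinorDeriv_smul hf hψ _)

/-- `[D, f] = -i c(df)`. -/
lemma mulSpinor_sub_of_isDirac {ψ χ χ' : S.testSpinors} {f : M → ℝ}
    (hf : ContMDiff (𝓡 n) 𝓘(ℝ, ℂ) ∞ fun x => (f x : ℂ)) (h : S.IsDirac ψ.1 χ.1)
    (h' : S.IsDirac (S.mulSpinor _ hf ψ).1 χ'.1) {i : S.ι} {x : M} (hx : x ∈ S.U i) :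
    (χ' - S.mulSpinor _ hf χ).1 i x = (-Complex.I) • S.c i x (differential f x) (ψ.1 i x) := by
  have hfd := (contMDiff_of_ofReal_comp hf x).mdifferentiableAt (by simp)
  change χ'.1 i x - (f x : ℂ) • χ.1 i x = _
  rw [h i x hx, h' i x hx]
  exact sum_clm_sub_smul _ fun a => S.nabla_smul hfd (S.mdifferentiableAt_testSpinor ψ hx) i a

end Leibniz

end SpinStructure

end

/-! ### From operator identities on L² to pointwise identities. -/

section

open MeasureTheory

section Operators

variable {H : Type*} [NormedAddCommGroup H] [InnerProductSpace ℂ H]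

lemma UnboundedOp.mem_graph_mul {f g : H →ₗ.[ℂ] H} {x y z : H} (h1 : (x, y) ∈ g.graph)
    (h2 : (y, z) ∈ f.graph) : (x, z) ∈ (UnboundedOp.mul f g).graph := by
  rw [LinearPMap.mem_graph_iff] at h1 h2 ⊢
  obtain ⟨⟨x, hx⟩, rfl, rfl⟩ := h1
  obtain ⟨⟨y, hy⟩, h, rfl⟩ := h2
  obtain rfl : y = g ⟨x, hx⟩ := h
  exact ⟨⟨x, hx, hy⟩, rfl, rfl⟩

lemma UnboundedOp.mem_graph_ofBounded (B : H →L[ℂ] H) (x : H) :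
    (x, B x) ∈ (UnboundedOp.ofBounded B).graph :=
  (LinearPMap.mem_graph_iff _).2 ⟨⟨x, trivial⟩, rfl, rfl⟩

lemma LinearPMap.sub_mem_graph_sub {f g : H →ₗ.[ℂ] H} {x y z : H} (h1 : (x, y) ∈ f.graph)
    (h2 : (x, z) ∈ g.graph) : (x, y - z) ∈ (f - g).graph := by
  rw [LinearPMap.mem_graph_iff] at h1 h2 ⊢
  obtain ⟨⟨x, hx⟩, rfl, rfl⟩ := h1
  obtain ⟨⟨x, hx'⟩, h, rfl⟩ := h2
  obtain rfl : x = _ := h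
  exact ⟨⟨x, hx, hx'⟩, rfl, rfl⟩

/-- (J²)⁻¹J is a bounded left inverse of J. -/
lemma exists_norm_sq_le_of_isUnit_mul_self {J : H →L[ℂ] H} (hJ : IsUnit (J * J)) :
    ∃ C : ℝ, ∀ x, ‖x‖ ^ 2 ≤ C * ‖J x‖ ^ 2 := by
  obtain ⟨u, hu⟩ := hJ
  refine ⟨(‖(↑u⁻¹ : H →L[ℂ] H)‖ * ‖J‖) ^ 2, fun x => ?_⟩
  have h : (↑u⁻¹ : H →L[ℂ] H) (J (J x)) = x := by
    have h0 : (↑u⁻¹ : H →L[ℂ] H) * (J * J) = 1 := by rw [← hu, Units.inv_mul]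
    exact congrArg (fun B : H →L[ℂ] H => B x) h0
  rw [← mul_pow]
  refine pow_le_pow_left₀ (norm_nonneg _) ?_ 2
  calc ‖x‖ = ‖(↑u⁻¹ : H →L[ℂ] H) (J (J x))‖ := by rw [h]
    _ ≤ ‖(↑u⁻¹ : H →L[ℂ] H)‖ * (‖J‖ * ‖J x‖) :=
        ((↑u⁻¹ : H →L[ℂ] H).le_opNorm _).trans
          (mul_le_mul_of_nonneg_left (J.le_opNorm _) (norm_nonneg _))
    _ = _ := by ring

variable [CompleteSpace H]

lemma LinearPMap.inner_eq_neg_of_adjoint_eq_neg {P : H →ₗ.[ℂ] H} (hd : Dense (P.domain : Set H))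
    (hP : P.adjoint = -P) {x x' y y' : H} (hx : (x, x') ∈ P.graph) (hy : (y, y') ∈ P.graph) :
    ⟪x', y⟫_ℂ = -⟪x, y'⟫_ℂ := by
  rw [LinearPMap.mem_graph_iff] at hx hy
  obtain ⟨⟨x, hx⟩, rfl, rfl⟩ := hx
  obtain ⟨⟨y, hy⟩, rfl, rfl⟩ := hy
  have h := LinearPMap.adjoint_isFormalAdjoint hd
  rw [hP] at h
  have h1 : ⟪-P ⟨x, hx⟩, y⟫_ℂ = ⟪x, P ⟨y, hy⟩⟫_ℂ := h ⟨x, hx⟩ ⟨y, hy⟩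
  rw [inner_neg_left] at h1
  rw [← h1, neg_neg]

end Operators

variable {n : ℕ} {M : Type*} [TopologicalSpace M] [ChartedSpace (EuclideanSpace ℝ (Fin n)) M]
  [IsManifold (𝓡 n) ∞ M]

namespace SpinStructure

variable {g : PseudoRiemannianMetric n M} (S : SpinStructure g)

lemma hasCompactSupport_pointwiseInner [T2Space M] (ψ φ : S.testSpinors) :
    HasCompactSupport (S.pointwiseInner ψ.1 φ.1) := by
  obtain ⟨K, hK, h⟩ := ψ.2.2.2.2
  refine HasCompactSupport.intro hK fun x hx => ?_
  rw [pointwiseInner, h _ x hx, inner_zero_left]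

lemma integrable_pointwiseInner [T2Space M] [MeasurableSpace M] [BorelSpace M] (m : Measure M)
    [IsLocallyFiniteMeasure m] (ψ φ : S.testSpinors) :
    Integrable (S.pointwiseInner ψ.1 φ.1) m :=
  (S.continuous_pointwiseInner ψ φ).integrable_of_hasCompactSupport
    (S.hasCompactSupport_pointwiseInner ψ φ)

lemma pointwiseInner_mulSpinor_left {f : M → ℝ}
    (hf : ContMDiff (𝓡 n) 𝓘(ℝ, ℂ) ∞ fun x => (f x : ℂ)) (ψ φ : S.testSpinors) (x : M) :
    S.pointwiseInner (S.mulSpinor _ hf ψ).1 φ.1 x = (f x : ℂ) * S.pointwiseInner ψ.1 φ.1 x := by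
  refine (inner_smul_left _ _ _).trans ?_
  rw [Complex.conj_ofReal]
  rfl

lemma pointwiseInner_mulSpinor_right {f : M → ℝ}
    (hf : ContMDiff (𝓡 n) 𝓘(ℝ, ℂ) ∞ fun x => (f x : ℂ)) (ψ φ : S.testSpinors) (x : M) :
    S.pointwiseInner ψ.1 (S.mulSpinor _ hf φ).1 x = (f x : ℂ) * S.pointwiseInner ψ.1 φ.1 x :=
  inner_smul_right _ _ _

end SpinStructure

namespace ComesFromSpinManifold

variable [MeasurableSpace M]
  {H : Type*} [NormedAddCommGroup H] [InnerProductSpace ℂ H] [CompleteSpace H]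
  {X : TemporalLorentzianSpectralTriple H} {g : PseudoRiemannianMetric n M} {S : SpinStructure g}
  {time : M → ℝ} (hS : ComesFromSpinManifold X S time)

lemma inner_toH_mulSpinor {f : M → ℝ} (hf : ContMDiff (𝓡 n) 𝓘(ℝ, ℂ) ∞ fun x => (f x : ℂ))
    (ψ φ : S.testSpinors) :
    ⟪hS.toH (S.mulSpinor _ hf ψ), hS.toH φ⟫_ℂ = ⟪hS.toH ψ, hS.toH (S.mulSpinor _ hf φ)⟫_ℂ := by
  simp only [hS.inner_toH, S.pointwiseInner_mulSpinor_left, S.pointwiseInner_mulSpinor_right]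

variable [T2Space M] [BorelSpace M]

/-- A pointwise acting operator on spinor fields which satisfies an inequality of quadratic forms
satisfies it pointwise. -/
lemma norm_sq_le_of_norm_toH_sq_le {A : S.ι → M → (SpinorSpace n →L[ℂ] SpinorSpace n)}
    {B : S.testSpinors → S.testSpinors}
    (hB : ∀ ψ, ∀ i, ∀ x ∈ S.U i, (B ψ).1 i x = A i x (ψ.1 i x)) {C : ℝ}
    (h : ∀ ψ, ‖hS.toH ψ‖ ^ 2 ≤ C * ‖hS.toH (B ψ)‖ ^ 2) {i : S.ι} {x : M} (hx : x ∈ S.U i)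
    (s : SpinorSpace n) : ‖s‖ ^ 2 ≤ C * ‖A i x s‖ ^ 2 := by
  have := hS.isVolume.isLocallyFiniteMeasure
  have := hS.isVolume.isOpenPosMeasure
  obtain ⟨ψ, rfl⟩ := S.exists_testSpinor hx s
  have hre : ∀ φ : S.testSpinors, ‖hS.toH φ‖ ^ 2 =
      ∫ y, (S.pointwiseInner φ.1 φ.1 y).re ∂hS.vol := by
    intro φ
    rw [← inner_self_eq_norm_sq (𝕜 := ℂ), hS.inner_toH]
    exact (integral_re (S.integrable_pointwiseInner hS.vol φ φ)).symm
  have hcont : ∀ φ : S.testSpinors, Continuous fun y => (S.pointwiseInner φ.1 φ.1 y).re :=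
    fun φ => Complex.continuous_re.comp (S.continuous_pointwiseInner φ φ)
  have key := nonneg_of_integral_sq_mul_nonneg (n := n) hS.vol
    (h := fun y => C * (S.pointwiseInner (B ψ).1 (B ψ).1 y).re - (S.pointwiseInner ψ.1 ψ.1 y).re)
    ((continuous_const.mul (hcont _)).sub (hcont _)) ?_ x
  · rw [S.pointwiseInner_eq _ _ hx, S.pointwiseInner_eq _ _ hx, hB ψ i x hx] at key
    have e : ∀ t : SpinorSpace n, (⟪t, t⟫_ℂ).re = ‖t‖ ^ 2 :=
      fun t => inner_self_eq_norm_sq (𝕜 := ℂ) t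
    rw [e, e] at key
    linarith
  · intro ρ hρ
    have hρ' := contMDiff_ofReal_comp hρ
    have h1 := h (S.mulSpinor _ hρ' ψ)
    -- Acting by linear maps in each fibre, `B` commutes with multiplication by functions.
    have hBρ : B (S.mulSpinor _ hρ' ψ) = S.mulSpinor _ hρ' (B ψ) := by
      refine S.testSpinors_ext fun j y hy => ?_
      rw [hB _ j y hy]
      change A j y ((ρ y : ℂ) • ψ.1 j y) = (ρ y : ℂ) • (B ψ).1 j y
      rw [hB _ j y hy, map_smul]
    rw [hBρ, hre, hre, ← integral_const_mul, ← sub_nonneg, ← integral_sub] at h1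
    · refine h1.trans_eq (integral_congr_ae (Filter.Eventually.of_forall fun y => ?_))
      simp only [S.pointwiseInner_mulSpinor_left, S.pointwiseInner_mulSpinor_right,
        Complex.re_ofReal_mul]
      ring
    · exact (S.integrable_pointwiseInner hS.vol _ _).re.const_mul C
    · exact (S.integrable_pointwiseInner hS.vol _ _).re

/-- A pointwise acting symmetric operator on spinor fields is pointwise self-adjoint. -/
lemma isSelfAdjoint_of_inner_toH_eq {A : S.ι → M → (SpinorSpace n →L[ℂ] SpinorSpace n)}
    {B : S.testSpinors → S.testSpinors}
    (hB : ∀ ψ, ∀ i, ∀ x ∈ S.U i, (B ψ).1 i x = A i x (ψ.1 i x))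
    (h : ∀ ψ φ, ⟪hS.toH (B ψ), hS.toH φ⟫_ℂ = ⟪hS.toH ψ, hS.toH (B φ)⟫_ℂ) {i : S.ι} {x : M}
    (hx : x ∈ S.U i) : IsSelfAdjoint (A i x) := by
  have := hS.isVolume.isLocallyFiniteMeasure
  have := hS.isVolume.isOpenPosMeasure
  rw [ContinuousLinearMap.isSelfAdjoint_iff_isSymmetric]
  intro s t
  obtain ⟨ψ, rfl⟩ := S.exists_testSpinor hx s
  obtain ⟨φ, rfl⟩ := S.exists_testSpinor hx t
  set F : M → ℂ := fun y => S.pointwiseInner (B ψ).1 φ.1 y - S.pointwiseInner ψ.1 (B φ).1 y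
    with hF
  have hFc : Continuous F :=
    (S.continuous_pointwiseInner _ _).sub (S.continuous_pointwiseInner _ _)
  have hint : ∀ ρ : M → ℝ, ContMDiff (𝓡 n) 𝓘(ℝ, ℝ) ∞ ρ →
      Integrable (fun y => ((ρ y ^ 2 : ℝ) : ℂ) * F y) hS.vol ∧
        ∫ y, ((ρ y ^ 2 : ℝ) : ℂ) * F y ∂hS.vol = 0 := by
    intro ρ hρ
    have hρ' := contMDiff_ofReal_comp hρ
    have hBρ : ∀ ψ, B (S.mulSpinor _ hρ' ψ) = S.mulSpinor _ hρ' (B ψ) := by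
      intro ψ
      refine S.testSpinors_ext fun j y hy => ?_
      rw [hB _ j y hy]
      change A j y ((ρ y : ℂ) • ψ.1 j y) = (ρ y : ℂ) • (B ψ).1 j y
      rw [hB _ j y hy, map_smul]
    have h1 := h (S.mulSpinor _ hρ' ψ) (S.mulSpinor _ hρ' φ)
    have i1 := S.integrable_pointwiseInner hS.vol (S.mulSpinor _ hρ' (B ψ)) (S.mulSpinor _ hρ' φ)
    have i2 := S.integrable_pointwiseInner hS.vol (S.mulSpinor _ hρ' ψ) (S.mulSpinor _ hρ' (B φ))
    rw [hBρ, hBρ, hS.inner_toH, hS.inner_toH, ← sub_eq_zero, ← integral_sub i1 i2] at h1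
    have e : (fun y => S.pointwiseInner (S.mulSpinor _ hρ' (B ψ)).1 (S.mulSpinor _ hρ' φ).1 y -
        S.pointwiseInner (S.mulSpinor _ hρ' ψ).1 (S.mulSpinor _ hρ' (B φ)).1 y) =
        fun y => ((ρ y ^ 2 : ℝ) : ℂ) * F y := by
      funext y
      simp only [S.pointwiseInner_mulSpinor_left, S.pointwiseInner_mulSpinor_right, hF,
        Complex.ofReal_pow]
      ring
    rw [e] at h1
    exact ⟨e ▸ i1.sub i2, h1⟩
  -- The localisation lemma concerns real functions, so it is applied to Re(zF) for every z; z equal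
  -- to minus the conjugate of F(x) then forces F(x) = 0.
  have key : ∀ z : ℂ, 0 ≤ (z * F x).re := fun z => by
    refine nonneg_of_integral_sq_mul_nonneg (n := n) hS.vol (h := fun y => (z * F y).re)
      (Complex.continuous_re.comp (continuous_const.mul hFc)) (fun ρ hρ => ?_) x
    obtain ⟨h1, h2⟩ := hint ρ hρ
    have h3 := integral_re (h1.const_mul z)
    rw [integral_const_mul, h2, mul_zero] at h3
    refine le_of_eq (Eq.trans ?_ (h3.symm.trans (integral_congr_ae
      (Filter.Eventually.of_forall fun y => ?_))))
    · simp
    · simp only [mul_left_comm z]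
      exact Complex.re_ofReal_mul _ _
  have hF0 : F x = 0 := by
    have h1 := key (-(starRingEnd ℂ (F x)))
    rw [neg_mul, mul_comm, Complex.mul_conj, Complex.neg_re, Complex.ofReal_re] at h1
    exact Complex.normSq_eq_zero.1 (le_antisymm (by linarith) (Complex.normSq_nonneg _))
  rw [hF] at hF0
  simp only [S.pointwiseInner_eq _ _ hx, hB _ i x hx] at hF0
  exact sub_eq_zero.1 hF0

end ComesFromSpinManifold

end

/-! ### The commutators of the triple as Clifford multiplications. -/

section

open MeasureTheory

section Algebra

variable {A : Type*} [Ring A] [StarRing A] [Algebra ℂ A]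

lemma isSelfAdjoint_mul_of_I_smul {t y : A}
    (h : IsSelfAdjoint (((-Complex.I) • t) * ((-Complex.I) • y))) : IsSelfAdjoint (t * y) := by
  rw [smul_mul_smul_comm, neg_mul_neg, Complex.I_mul_I, neg_one_smul] at h
  simpa using h.neg

lemma star_mul_self_of_star_eq_neg {t : A} {r : ℝ} (h : star t = -t)
    (ht : t * t = (r : ℂ) • 1) : star t * t = ((-r : ℝ) : ℂ) • 1 := by
  rw [h, neg_mul, ht, Complex.ofReal_neg, neg_smul]

variable [StarModule ℂ A]

lemma star_eq_neg_of_isSelfAdjoint_I_smul {t : A} (h : IsSelfAdjoint ((-Complex.I) • t)) :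
    star t = -t := by
  have h1 := h.star_eq
  rw [star_smul] at h1
  have h2 : star (-Complex.I) = Complex.I := by simp
  rw [h2, neg_smul, ← smul_neg] at h1
  exact smul_right_injective _ Complex.I_ne_zero h1

end Algebra

variable {n : ℕ} {M : Type*} [TopologicalSpace M] [ChartedSpace (EuclideanSpace ℝ (Fin n)) M]
  [IsManifold (𝓡 n) ∞ M]

namespace ComesFromSpinManifold

variable [MeasurableSpace M]
  {H : Type*} [NormedAddCommGroup H] [InnerProductSpace ℂ H] [CompleteSpace H]
  {X : TemporalLorentzianSpectralTriple H} {g : PseudoRiemannianMetric n M} {S : SpinStructure g}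
  {time : M → ℝ} (hS : ComesFromSpinManifold X S time)

/-- `[D, T]` acts as `-i c(dT)`. -/
lemma exists_commDT (ψ : S.testSpinors) : ∃ χ : S.testSpinors,
    X.commDT (hS.toH ψ) = hS.toH χ ∧ ∀ i, ∀ x ∈ S.U i,
      χ.1 i x = ((-Complex.I) • S.c i x (differential time x)) (ψ.1 i x) := by
  obtain ⟨χ, h1, h2⟩ := hS.D_dirac ψ
  obtain ⟨χ', h3, h4⟩ := hS.D_dirac (S.mulSpinor _ hS.time_smooth ψ)
  refine ⟨χ' - S.mulSpinor _ hS.time_smooth χ, ?_, fun i x hx =>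
    S.mulSpinor_sub_of_isDirac hS.time_smooth h1 h3 hx⟩
  rw [map_sub]
  -- T and D preserve test spinors, so these lie in the domain of DT - TD itself; its closure is not
  -- needed.
  refine ((X.commDT_eq _ _).1 (subset_closure ?_)).symm
  exact LinearPMap.sub_mem_graph_sub (UnboundedOp.mem_graph_mul (hS.T_mul ψ) h4)
    (UnboundedOp.mem_graph_mul h2 (hS.T_mul χ))

lemma mem_graph_commDT_mul_D {ψ : S.testSpinors} {y : H} (h : (hS.toH ψ, y) ∈ X.D.graph) :
    (hS.toH ψ, X.commDT y) ∈ (UnboundedOp.mul (UnboundedOp.ofBounded X.commDT) X.D).graph :=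
  UnboundedOp.mem_graph_mul h (UnboundedOp.mem_graph_ofBounded _ _)

lemma dense_domain_commDT_mul_D (hS : ComesFromSpinManifold X S time) :
    Dense ((UnboundedOp.mul (UnboundedOp.ofBounded X.commDT) X.D).domain : Set H) := by
  refine Dense.mono ?_ hS.dense_toH
  rintro _ ⟨ψ, rfl⟩
  obtain ⟨χ, -, h⟩ := hS.D_dirac ψ
  exact LinearPMap.mem_domain_of_mem_graph (hS.mem_graph_commDT_mul_D h)

/-- `[[D, T] D, f]` acts as `(-i c(dT)) (-i c(df))`, and equals the difference of the values
of `[D, T] D f` and `f [D, T] D`. -/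
lemma exists_commutator {f : M → ℝ} (hf : ContMDiff (𝓡 n) 𝓘(ℝ, ℂ) ∞ fun x => (f x : ℂ))
    (ψ : S.testSpinors) : ∃ κ θ θ' : S.testSpinors, κ = θ' - S.mulSpinor _ hf θ ∧
    (hS.toH ψ, hS.toH θ) ∈ (UnboundedOp.mul (UnboundedOp.ofBounded X.commDT) X.D).graph ∧
    (hS.toH (S.mulSpinor _ hf ψ), hS.toH θ') ∈
      (UnboundedOp.mul (UnboundedOp.ofBounded X.commDT) X.D).graph ∧
    ∀ i, ∀ x ∈ S.U i, κ.1 i x = (((-Complex.I) • S.c i x (differential time x)) *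
      ((-Complex.I) • S.c i x (differential f x))) (ψ.1 i x) := by
  obtain ⟨χ, h1, h2⟩ := hS.D_dirac ψ
  obtain ⟨χ', h3, h4⟩ := hS.D_dirac (S.mulSpinor _ hf ψ)
  obtain ⟨θ, h5, h6⟩ := hS.exists_commDT χ
  obtain ⟨θ', h7, h8⟩ := hS.exists_commDT χ'
  refine ⟨_, θ, θ', rfl, h5 ▸ hS.mem_graph_commDT_mul_D h2, h7 ▸ hS.mem_graph_commDT_mul_D h4,
    fun i x hx => ?_⟩
  -- [D, T] acts fibrewise and so commutes with f, giving [[D, T]D, f] = [D, T][D, f].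
  have h9 := S.mulSpinor_sub_of_isDirac hf h1 h3 hx
  change χ'.1 i x - (f x : ℂ) • χ.1 i x = _ at h9
  change θ'.1 i x - (f x : ℂ) • θ.1 i x = ((-Complex.I) • S.c i x (differential time x))
    ((-Complex.I) • S.c i x (differential f x) (ψ.1 i x))
  rw [h6 i x hx, h8 i x hx, ← h9, map_sub, map_smul]

/-- The commutator of a skew operator with a symmetric one is symmetric. It is phrased through graph
elements because [D, T]D is unbounded. -/
lemma inner_commutator {f : M → ℝ} (hf : ContMDiff (𝓡 n) 𝓘(ℝ, ℂ) ∞ fun x => (f x : ℂ))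
    {B : S.testSpinors → S.testSpinors}
    (hB : ∀ ψ, ∃ θ θ' : S.testSpinors, B ψ = θ' - S.mulSpinor _ hf θ ∧
      (hS.toH ψ, hS.toH θ) ∈ (UnboundedOp.mul (UnboundedOp.ofBounded X.commDT) X.D).graph ∧
      (hS.toH (S.mulSpinor _ hf ψ), hS.toH θ') ∈
        (UnboundedOp.mul (UnboundedOp.ofBounded X.commDT) X.D).graph) (ψ φ : S.testSpinors) :
    ⟪hS.toH (B ψ), hS.toH φ⟫_ℂ = ⟪hS.toH ψ, hS.toH (B φ)⟫_ℂ := by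
  obtain ⟨θ, θ', h1, h2, h3⟩ := hB ψ
  obtain ⟨κ, κ', k1, k2, k3⟩ := hB φ
  have key := fun {x x' y y' : H} => LinearPMap.inner_eq_neg_of_adjoint_eq_neg (x := x) (x' := x')
    (y := y) (y' := y') hS.dense_domain_commDT_mul_D X.skewAdjoint
  rw [h1, k1, map_sub, map_sub, inner_sub_left, inner_sub_right, key h3 k2,
    hS.inner_toH_mulSpinor, hS.inner_toH_mulSpinor, key h2 k3]
  ring

variable [T2Space M] [BorelSpace M]

/-- Each property comes from one axiom: `star_eq` from self-adjointness of [D, T], `neg` from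
invertibility of its square, `isSelfAdjoint_mul` from skew-adjointness of [D, T]D. -/
lemma isTemporal (hS : ComesFromSpinManifold X S time) {i : S.ι} {x : M} (hx : x ∈ S.U i) :
    S.IsTemporal i x (differential time x) := by
  choose J hJ1 hJ2 using hS.exists_commDT
  have hstar : star (S.c i x (differential time x)) = -S.c i x (differential time x) := by
    have h : IsSelfAdjoint ((-Complex.I) • S.c i x (differential time x)) :=
      (hS.isSelfAdjoint_of_inner_toH_eq (i := i) hJ2 (fun ψ φ => by
        rw [← hJ1, ← hJ1]
        exact (ContinuousLinearMap.isSelfAdjoint_iff_isSymmetric.1 X.commDT_selfAdjoint) _ _) hx)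
    exact star_eq_neg_of_isSelfAdjoint_I_smul (A := SpinorSpace n →L[ℂ] SpinorSpace n)
      (t := S.c i x (differential time x)) h
  refine ⟨hx, ?_, hstar, fun ξ => ?_⟩
  · obtain ⟨C, hC⟩ := exists_norm_sq_le_of_isUnit_mul_self X.commDT_sq_pos.isUnit
    obtain ⟨s, hs⟩ := exists_ne (0 : SpinorSpace n)
    have h1 := hS.norm_sq_le_of_norm_toH_sq_le hJ2 (C := C) (fun ψ => hJ1 ψ ▸ hC _) hx s
    have h2 : star (S.c i x (differential time x)) * S.c i x (differential time x) =
        ((-g.cometric x (differential time x) (differential time x) : ℝ) : ℂ) • 1 :=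
      star_mul_self_of_star_eq_neg (A := SpinorSpace n →L[ℂ] SpinorSpace n) hstar
        (S.c_mul_self hx (differential time x))
    have h3 := norm_sq_of_star_mul_self h2 s
    have h4 : ‖((-Complex.I) • S.c i x (differential time x)) s‖ =
        ‖S.c i x (differential time x) s‖ := by
      refine (norm_smul (-Complex.I) (S.c i x (differential time x) s)).trans ?_
      simp
    rw [h4, h3] at h1
    have h5 : 0 < ‖s‖ ^ 2 := by positivity
    have h6 : 0 ≤ -g.cometric x (differential time x) (differential time x) := by
      by_contra! h
      nlinarith [sq_nonneg ‖S.c i x (differential time x) s‖]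
    -- A null dT would turn the lower bound on [D, T] into ‖s‖² ≤ 0.
    refine lt_of_le_of_ne (by linarith) fun h7 => ?_
    rw [h7] at h1
    linarith
  · obtain ⟨f, hf, rfl⟩ := exists_differential_eq x ξ
    choose B θ θ' h1 h2 h3 h4 using hS.exists_commutator (contMDiff_ofReal_comp hf)
    have h := (hS.isSelfAdjoint_of_inner_toH_eq (i := i) h4
      (hS.inner_commutator (contMDiff_ofReal_comp hf)
        fun ψ => ⟨θ ψ, θ' ψ, h1 ψ, h2 ψ, h3 ψ⟩) hx)
    exact isSelfAdjoint_mul_of_I_smul (A := SpinorSpace n →L[ℂ] SpinorSpace n)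
      (t := S.c i x (differential time x)) (y := S.c i x (differential f x)) h

end ComesFromSpinManifold

end

/-! ### Coordinate differentials, smoothness, and the splitting of the metric. -/

section

open Bundle

lemma contDiff_smulRight_self (V : Type*) [NormedAddCommGroup V] [NormedSpace ℝ V] :
    ContDiff ℝ ∞ fun a : V →L[ℝ] ℝ => a.smulRight a :=
  contDiff_id.smulRight contDiff_id

variable {n : ℕ} {M : Type*} [TopologicalSpace M] [ChartedSpace (EuclideanSpace ℝ (Fin n)) M]

lemma differential_coordFun_coordVec {e : OpenPartialHomeomorph M (EuclideanSpace ℝ (Fin n))}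
    (he : e ∈ IsManifold.maximalAtlas (𝓡 n) ∞ M) {y : EuclideanSpace ℝ (Fin n)}
    (hy : y ∈ e.target) (μ k : Fin n) :
    differential (coordFun e μ) (e.symm y) (coordVec e k y) = if μ = k then 1 else 0 := by
  have hd := mdifferentiable_of_mem_maximalAtlas he
  have h1 : MDifferentiableAt (𝓡 n) (𝓡 n) e.symm y := hd.symm.mdifferentiableAt hy
  have h2 : MDifferentiableAt (𝓡 n) (𝓡 n) e (e.symm y) := hd.mdifferentiableAt (e.map_target hy)
  let p : EuclideanSpace ℝ (Fin n) →L[ℝ] ℝ := EuclideanSpace.proj μ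
  have h3 : HasMFDerivAt (𝓡 n) 𝓘(ℝ, ℝ) (coordFun e μ) (e.symm y)
      (p.comp (mfderiv (𝓡 n) (𝓡 n) e (e.symm y))) :=
    p.hasMFDerivAt.comp (e.symm y) h2.hasMFDerivAt
  have h4 := h3.comp y h1.hasMFDerivAt
  have h5 : coordFun e μ ∘ e.symm =ᶠ[𝓝 y] p := by
    filter_upwards [e.open_target.mem_nhds hy] with z hz
    simp [coordFun, p, e.right_inv hz]
  have h6 := hasMFDerivAt_unique (h4.congr_of_eventuallyEq h5.symm) p.hasMFDerivAt
  rw [differential, h3.mfderiv]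
  refine (congrArg (fun L : EuclideanSpace ℝ (Fin n) →L[ℝ] ℝ =>
    L (EuclideanSpace.single k (1 : ℝ))) h6).trans ?_
  simp [p]

variable [IsManifold (𝓡 n) ∞ M]

/-- The coordinate expression of dτ near x₀, in the form that the trivialisation of the bundle of
bilinear forms produces. -/
lemma contMDiffAt_differential_comp_symmL {τ : M → ℝ} (hτ : ContMDiff (𝓡 n) 𝓘(ℝ, ℝ) ∞ τ)
    (x₀ : M) : ContMDiffAt (𝓡 n) 𝓘(ℝ, EuclideanSpace ℝ (Fin n) →L[ℝ] ℝ) ∞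
      (fun x => (differential τ x).comp ((trivializationAt (EuclideanSpace ℝ (Fin n))
        (TangentSpace (𝓡 n) : M → Type _) x₀).symmL ℝ x)) x₀ := by
  have h := (hτ x₀).mfderiv_const (m := ∞) (by simp)
  refine h.congr_of_eventuallyEq (Filter.Eventually.of_forall fun x => ?_)
  ext v
  simp [inTangentCoordinates, ContinuousLinearMap.inCoordinates, differential]
  rfl

lemma isSmoothTwoTensor_differential_sq {τ : M → ℝ} (hτ : ContMDiff (𝓡 n) 𝓘(ℝ, ℝ) ∞ τ) :
    IsSmoothTwoTensor (n := n) (M := M)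
      fun x => (differential τ x).smulRight (differential τ x) := by
  intro x₀
  rw [contMDiffAt_section]
  refine ((contDiff_smulRight_self (EuclideanSpace ℝ (Fin n))).contMDiff.contMDiffAt.comp x₀
    (contMDiffAt_differential_comp_symmL hτ x₀)).congr_of_eventuallyEq ?_
  -- Over the base set, dτ ⊗ dτ reads a ⊗ a with a the coordinate expression of dτ.
  filter_upwards [(trivializationAt (EuclideanSpace ℝ (Fin n))
    (TangentSpace (𝓡 n) : M → Type _) x₀).open_baseSet.mem_nhds
    (FiberBundle.mem_baseSet_trivializationAt' x₀)] with x hx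
  ext v w
  have hx' : x ∈ (trivializationAt (EuclideanSpace ℝ (Fin n) →L[ℝ] ℝ)
      (fun x : M => TangentSpace (𝓡 n) x →L[ℝ] ℝ) x₀).baseSet := ⟨hx, trivial⟩
  simp only [hom_trivializationAt_apply, ContinuousLinearMap.inCoordinates,
    ContinuousLinearMap.coe_comp, Function.comp_apply]
  rw [Trivialization.continuousLinearMapAt_apply, Trivialization.linearMapAt_apply, if_pos hx',
    hom_trivializationAt_apply]
  simp only [ContinuousLinearMap.inCoordinates, Trivial.fiberBundle_trivializationAt',
    Trivial.continuousLinearMapAt_trivialization]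
  rfl

lemma contMDiffAt_differential_apply {τ : M → ℝ} (hτ : ContMDiff (𝓡 n) 𝓘(ℝ, ℝ) ∞ τ)
    {E : (x : M) → TangentSpace (𝓡 n) x} {x : M}
    (hE : ContMDiffAt (𝓡 n) (𝓡 n).tangent ∞ (fun x => (⟨x, E x⟩ : TangentBundle (𝓡 n) M)) x) :
    ContMDiffAt (𝓡 n) 𝓘(ℝ, ℝ) ∞ (fun x => differential τ x (E x)) x :=
  (contMDiff_snd_tangentBundle_modelSpace ℝ 𝓘(ℝ, ℝ)).contMDiffAt.comp x
    ((hτ.contMDiff_tangentMap (m := ∞) (by simp)).contMDiffAt.comp x hE)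

namespace SpinStructure

variable {g : PseudoRiemannianMetric n M} (S : SpinStructure g)

lemma contMDiff_cometric_differential (S : SpinStructure g) {τ : M → ℝ}
    (hτ : ContMDiff (𝓡 n) 𝓘(ℝ, ℝ) ∞ τ) :
    ContMDiff (𝓡 n) 𝓘(ℝ, ℝ) ∞ fun x => g.cometric x (differential τ x) (differential τ x) := by
  intro x
  obtain ⟨i, hx⟩ := S.cover x
  have hE : ∀ a, ContMDiffAt (𝓡 n) 𝓘(ℝ, ℝ) ∞ (fun x => differential τ x (S.E i a x)) x :=
    fun a => contMDiffAt_differential_apply hτ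
      ((S.E_smooth i a).contMDiffAt ((S.isOpen_U i).mem_nhds hx))
  have h : ContMDiffAt (𝓡 n) 𝓘(ℝ, ℝ) ∞ (fun x => ∑ a, S.gam.η a *
      differential τ x (S.E i a x) * differential τ x (S.E i a x)) x :=
    ContMDiffAt.sum fun a _ => (contMDiffAt_const.mul (hE a)).mul (hE a)
  refine h.congr_of_eventuallyEq ?_
  filter_upwards [(S.isOpen_U i).mem_nhds hx] with y hy
  exact S.cometric_eq_sum hy _ _

/-- The gradient of τ is the timelike vector; its orthogonal complement is the kernel of dτ. -/
lemma isLorentzian_of_isTemporal {τ : M → ℝ}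
    (h : ∀ i, ∀ x ∈ S.U i, S.IsTemporal i x (differential τ x)) : g.IsLorentzian := by
  intro x
  obtain ⟨i, hx⟩ := S.cover x
  refine ⟨g.sharp x (differential τ x), ?_, fun w hw hw0 => ?_⟩
  · rw [← g.cometric_eq_val_sharp]
    exact (h i x hx).neg
  · rw [g.sharp_spec] at hw
    exact (h i x hx).val_pos hw hw0

lemma splitsAlong_of_isTemporal {τ : M → ℝ} (hτ : ContMDiff (𝓡 n) 𝓘(ℝ, ℝ) ∞ τ)
    (h : ∀ i, ∀ x ∈ S.U i, S.IsTemporal i x (differential τ x)) : g.SplitsAlong τ := by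
  have hneg : ∀ x, g.cometric x (differential τ x) (differential τ x) < 0 := fun x => by
    obtain ⟨i, hx⟩ := S.cover x
    exact (h i x hx).neg
  -- This β is forced: h = g + β dτ² must kill ∇τ, that is, 1 + β g⁻¹(dτ,dτ) = 0.
  set β : M → ℝ := fun x => -(g.cometric x (differential τ x) (differential τ x))⁻¹ with hβ
  have hβs : ContMDiff (𝓡 n) 𝓘(ℝ, ℝ) ∞ β := fun x =>
    ((contDiffAt_inv ℝ (hneg x).ne).contMDiffAt.comp x
      (S.contMDiff_cometric_differential hτ x)).neg
  refine ⟨β, fun x => g.val x + β x • (differential τ x).smulRight (differential τ x), hβs,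
    fun x => neg_pos.2 (inv_lt_zero.2 (hneg x)), ?_, fun x v w => ?_, fun x => ⟨fun v w => ?_,
    fun v hv hv0 => ?_, fun w => ?_, ?_⟩⟩
  · exact g.smooth.add_section (hβs.smul_section (isSmoothTwoTensor_differential_sq hτ))
  · simp [g.symm x v w, mul_comm]
  · simp
  · obtain ⟨i, hx⟩ := S.cover x
    simpa [hv] using (h i x hx).val_pos hv hv0
  · have e : differential τ x (g.sharp x (differential τ x)) =
      g.cometric x (differential τ x) (differential τ x) := rfl
    have := (hneg x).ne
    simp only [add_apply, smul_apply, ContinuousLinearMap.smulRight_apply, g.sharp_spec, e, hβ,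
      smul_eq_mul]
    field_simp
    ring
  · exact (hneg x).ne

end SpinStructure

end

theorem mainTheorem1 {n : ℕ} {M : Type*} [TopologicalSpace M]
    [ChartedSpace (EuclideanSpace ℝ (Fin n)) M] [IsManifold (𝓡 n) ∞ M]
    [T2Space M] [SecondCountableTopology M] [MeasurableSpace M] [BorelSpace M]
    {H : Type*} [NormedAddCommGroup H] [InnerProductSpace ℂ H] [CompleteSpace H]
    (X : TemporalLorentzianSpectralTriple H) (hX : X.IsCommutative)
    (g : PseudoRiemannianMetric n M) (S : SpinStructure g) (time : M → ℝ)
    (hS : ComesFromSpinManifold X S time) :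
    -- `dT` is timelike everywhere, and the geometry is Lorentzian
    (∀ x : M, g.cometric x (differential time x) (differential time x) < 0) ∧
    g.IsLorentzian ∧
    -- `c(dT)` is anti-Hermitian, `c(ξ)` is Hermitian for `ξ` orthogonal to `dT`
    (∀ i, ∀ x ∈ S.U i,
      star (S.c i x (differential time x)) = -S.c i x (differential time x) ∧
      ∀ ξ, g.cometric x (differential time x) ξ = 0 → IsSelfAdjoint (S.c i x ξ)) ∧
    -- the metric splits globally
    g.SplitsAlong time ∧
    -- local coordinates with `x^0 = T` (the index called `0` in the comments is `k`)
    (∀ e ∈ IsManifold.maximalAtlas (𝓡 n) ∞ M, ∀ k : Fin n,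
      (∀ y ∈ e.source, coordFun e k y = time y) →
      ∀ i, ∀ x ∈ e.source ∩ S.U i,
        -- `g^{00} < 0`
        g.cometric x (differential (coordFun e k) x) (differential (coordFun e k) x) < 0 ∧
        -- if every `γ^μ` is Hermitian or anti-Hermitian, then `γ^μ` is Hermitian and
        -- `g^{0μ} = 0` for all `μ > 0`
        ((∀ μ, IsSelfAdjoint (S.c i x (differential (coordFun e μ) x)) ∨
            star (S.c i x (differential (coordFun e μ) x)) =
              -S.c i x (differential (coordFun e μ) x)) →
          ∀ μ, μ ≠ k →
            IsSelfAdjoint (S.c i x (differential (coordFun e μ) x)) ∧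
            g.cometric x (differential (coordFun e k) x)
              (differential (coordFun e μ) x) = 0)) := by
  have hT : ∀ i, ∀ x ∈ S.U i, S.IsTemporal i x (differential time x) := fun i x hx =>
    hS.isTemporal hx
  refine ⟨fun x => ?_, S.isLorentzian_of_isTemporal hT, fun i x hx =>
    ⟨(hT i x hx).star_eq, fun ξ hξ => (hT i x hx).isSelfAdjoint_c hξ⟩,
    S.splitsAlong_of_isTemporal (contMDiff_of_ofReal_comp (n := n) hS.time_smooth) hT, ?_⟩
  · obtain ⟨i, hx⟩ := S.cover x
    exact (hT i x hx).neg
  · intro e he k hk i x hx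
    have hd : differential (n := n) (coordFun e k) x = differential time x :=
      Filter.EventuallyEq.mfderiv_eq (Filter.mem_of_superset (e.open_source.mem_nhds hx.1) hk)
    have hx' := hT i x hx.2
    rw [← hd] at hx'
    refine ⟨hx'.neg, fun h μ hμ => ?_⟩
    have hsa : IsSelfAdjoint (S.c i x (differential (coordFun e μ) x)) := by
      -- An anti-Hermitian γ^μ would give dx^μ = r dx^k, and evaluating on ∂_μ yields 1 = 0.
      refine (h μ).resolve_right fun h1 => ?_
      obtain ⟨r, hr⟩ := hx'.exists_eq_smul_of_star_eq_neg h1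
      obtain ⟨y, hy, rfl⟩ : ∃ y ∈ e.target, e.symm y = x :=
        ⟨e x, e.map_source hx.1, e.left_inv hx.1⟩
      have h2 := differential_coordFun_coordVec he hy μ μ
      rw [hr, smul_apply, differential_coordFun_coordVec he hy k μ, if_neg hμ.symm] at h2
      simp at h2
    exact ⟨hsa, hx'.cometric_eq_zero_of_isSelfAdjoint hsa⟩

end
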